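/- Let $n\ge 2$ and let $f$ be a regular polynomial automorphism of $\mathbb C^n$: $f$ is a polynomial map with polynomial inverse, its degree $d$ (the maximum of the degrees of its components) is greater than one, and the indeterminacy sets $I^+$ and $I^-$ in $\mathbb P^n$ of the meromorphic extensions of $f$ and of $f^{-1}$ are disjoint. Put $$K^{\pm}=\{p\in\mathbb C^n:\ \{f^{\pm k}(p):k\in\mathbb N\}\text{ is bounded}\},\qquad K=K^+\cap K^-,\qquad J^{\pm}=\partial K^{\pm}.$$ Call a compact set $V\subset\mathbb C^n$ admissible if $K\subset\operatorname{int}V$, $f(J^+\cap V)\subset J^+\cap V$ and $f^{-1}(J^-\cap V)\subset J^-\cap V$. Let $\overline{\dim}_B A=\limsup_{\varepsilon\to0^+}\log N(A,\varepsilon)/\log(1/\varepsilon)$ denote the upper box dimension, where $N(A,\varepsilon)$ is the least number of balls of radius $\varepsilon$ covering $A$ (this is $+\infty$ if $A$ is unbounded). (1) Suppose that $f$ is volume decreasing, i.e. $|\det Df|<1$. Then admissible sets exist; there is a real number $s^->0$ such that for every admissible set $V$ $$s^-=\lim_{k\to\infty}\frac1k\log\Bigl(\max\{\|Df^{-k}(p)\|:p\in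 J^-\cap V\}\Bigr);$$ and for every admissible set $V$ $$\overline{\dim}_B(K^-\cap V)\ \le\ 2n+\frac{2\log|\det Df|}{s^-}\ <\ 2n .$$ (2) If $f$ is not volume preserving, i.e. if $|\det Df|\neq1$, then $\overline{\dim}_B K<2n$. -/

import Mathlib

open Set Filter Topology
open scoped NNReal ENNReal

noncomputable section

/-- A polynomial automorphism of `ℂⁿ`: a polynomial map together with a two-sided polynomial
inverse. -/
structure PolynomialAutomorphism (n : ℕ) where
  /-- the components `f₁, …, fₙ` of the map -/
  map : Fin n → MvPolynomial (Fin n) ℂ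
  /-- the components of the inverse map -/
  inv : Fin n → MvPolynomial (Fin n) ℂ
  inv_comp_map : ∀ i, MvPolynomial.bind₁ map (inv i) = MvPolynomial.X i
  map_comp_inv : ∀ i, MvPolynomial.bind₁ inv (map i) = MvPolynomial.X i

/-- The homogenization of degree `d` of `p`, for `d` at least the degree of `p`: in the variables
`z₀, z₁, …, zₙ`, this is `z₀ ^ d * p (z₁ / z₀, …, zₙ / z₀)`. -/
def homogenizeAt {n : ℕ} (d : ℕ) (p : MvPolynomial (Fin n) ℂ) :
    MvPolynomial (Fin (n + 1)) ℂ :=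
  ∑ m ∈ p.support, MvPolynomial.monomial (Finsupp.cons (d - m.degree) m) (p.coeff m)

/-- The degree of a polynomial map, the maximum of the degrees of its components. -/
def polyMapDegree {n : ℕ} (P : Fin n → MvPolynomial (Fin n) ℂ) : ℕ :=
  Finset.univ.sup fun i => (P i).totalDegree

/-- The homogeneous polynomial map `F = (z₀ ^ d, F₁, …, Fₙ)` of `ℂⁿ⁺¹` which induces the
meromorphic extension of the polynomial map `P` to `ℙⁿ`, where `d` is the degree of `P`. -/
def homogeneousLift {n : ℕ} (P : Fin n → MvPolynomial (Fin n) ℂ) :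
    Fin (n + 1) → MvPolynomial (Fin (n + 1)) ℂ :=
  Fin.cons (MvPolynomial.X 0 ^ polyMapDegree P) fun i => homogenizeAt (polyMapDegree P) (P i)

/-- The indeterminacy set in `ℙⁿ` of the meromorphic extension of the polynomial map `P`: the
image in `ℙⁿ` of the zero set of the homogeneous lift. -/
def indeterminacySet {n : ℕ} (P : Fin n → MvPolynomial (Fin n) ℂ) :
    Set (Projectivization ℂ (Fin (n + 1) → ℂ)) :=
  {x | ∀ i, MvPolynomial.eval x.rep (homogeneousLift P i) = 0}

namespace PolynomialAutomorphism

variable {n : ℕ} (f : PolynomialAutomorphism n)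

/-- The inverse automorphism. -/
def symm : PolynomialAutomorphism n where
  map := f.inv
  inv := f.map
  inv_comp_map := f.map_comp_inv
  map_comp_inv := f.inv_comp_map

/-- The automorphism as a self-map of `ℂⁿ`. -/
def toFun (p : EuclideanSpace ℂ (Fin n)) : EuclideanSpace ℂ (Fin n) :=
  WithLp.toLp 2 fun i => MvPolynomial.eval (WithLp.ofLp p) (f.map i)

/-- `f` is regular: its degree is greater than one, and the indeterminacy sets of the
meromorphic extensions of `f` and of its inverse are disjoint. -/
def IsRegular : Prop :=
  1 < polyMapDegree f.map ∧ Disjoint (indeterminacySet f.map) (indeterminacySet f.inv)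

/-- The complex Jacobian determinant `det Df` at `p`. -/
def jacobianDet (p : EuclideanSpace ℂ (Fin n)) : ℂ :=
  (fderiv ℂ f.toFun p).det

/-- `|det Df| < 1`. -/
def IsVolumeDecreasing : Prop := ∀ p, ‖f.jacobianDet p‖ < 1

/-- `|det Df| = 1`. -/
def IsVolumePreserving : Prop := ∀ p, ‖f.jacobianDet p‖ = 1

/-- `K⁺`, the set of points with bounded forward orbit. -/
def KPlus : Set (EuclideanSpace ℂ (Fin n)) :=
  {p | Bornology.IsBounded (range fun k : ℕ => f.toFun^[k] p)}

/-- `K⁻`, the set of points with bounded backward orbit. -/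
def KMinus : Set (EuclideanSpace ℂ (Fin n)) :=
  {p | Bornology.IsBounded (range fun k : ℕ => f.symm.toFun^[k] p)}

/-- The filled-in Julia set `K = K⁺ ∩ K⁻`. -/
def K : Set (EuclideanSpace ℂ (Fin n)) := f.KPlus ∩ f.KMinus

/-- The forward Julia set `J⁺ = ∂K⁺`. -/
def JPlus : Set (EuclideanSpace ℂ (Fin n)) := frontier f.KPlus

/-- The backward Julia set `J⁻ = ∂K⁻`. -/
def JMinus : Set (EuclideanSpace ℂ (Fin n)) := frontier f.KMinus

/-- The compact sets `V` with `K ⊆ int V`, `f (J⁺ ∩ V) ⊆ J⁺ ∩ V` and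
`f⁻¹ (J⁻ ∩ V) ⊆ J⁻ ∩ V`. -/
structure IsAdmissible (V : Set (EuclideanSpace ℂ (Fin n))) : Prop where
  isCompact : IsCompact V
  K_subset_interior : f.K ⊆ interior V
  mapsTo_JPlus : MapsTo f.toFun (f.JPlus ∩ V) (f.JPlus ∩ V)
  mapsTo_JMinus : MapsTo f.symm.toFun (f.JMinus ∩ V) (f.JMinus ∩ V)

/-- `(1 / k) log (max {‖Df⁻ᵏ(p)‖ : p ∈ J⁻ ∩ V})`, with the operator norm; the limit of this
sequence is `s⁻`. -/
def backwardGrowth (V : Set (EuclideanSpace ℂ (Fin n))) (k : ℕ) : ℝ :=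
  (1 / (k : ℝ)) *
    Real.log (sSup ((fun p => ‖fderiv ℂ (f.symm.toFun^[k]) p‖) '' (f.JMinus ∩ V)))

end PolynomialAutomorphism

/-- The upper box dimension `limsup_{ε → 0+} log N(A, ε) / log (1 / ε)` of `A`, where `N(A, ε)` is
the least number of closed balls of radius `ε` that cover `A`. It is `⊤` if `A` is not totally
bounded, and `⊥` if `A` is empty. -/
def upperBoxDim {X : Type*} [PseudoEMetricSpace X] (A : Set X) : EReal :=
  limsup (fun ε : ℝ≥0 =>
    ENNReal.log (Metric.externalCoveringNumber ε A : ℝ≥0∞) / ((-Real.log ε : ℝ) : EReal))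
    (𝓝[>] 0)

end

/-! Let `a = |det Df⁻¹| > 1` in the volume decreasing case; the Jacobian is constant because it is a
polynomial without zeros. If a compact set `A` is mapped into itself by `g = f⁻¹` and `‖Dg‖ < L` on
`A`, then `g` maps the `ε`-neighbourhood of `A` into the `Lε`-neighbourhood for small `ε`, while it
multiplies volume by `a ^ 2`. Hence the volume of the `δ / L ^ m`-neighbourhood is `O(a ^ (-2 *
m))`, and counting balls bounds the box dimension by `2n - 2 log a / log L`
(`upperBoxDim_le_of_mapsTo`). Applied to the iterates `g^[k]` this replaces `log L` by the growth
rate `s` of `‖Dg^[k]‖` on `A`; the rate exists by subadditivity, and it is positive because `a ^ k ≤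
n! * ‖Dg^[k]‖ ^ n`.

The set to use is `A = J⁻ ∩ V`. It equals `K⁻ ∩ V`: the parts of `K⁻` in large balls are mapped into
themselves by the volume expanding map `f⁻¹`, so `K⁻` is a null set and, being closed, is its own
boundary. The rate does not depend on `V`, since the backward images of `J⁻ ∩ V` shrink to a subset
of `K`, which lies in the interior of any other admissible set.

Regularity enters through an escape radius: the leading parts of `f` and `f⁻¹` have no common zero
but the origin, so far out one of the two maps doubles the norm. Large closed balls are therefore
admissible. The set `A` must also be nonempty, so `K` must be; this follows from a point with
`f(f(z)) = z`, that is, a zero of the proper polynomial map `f - f⁻¹`. -/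

noncomputable section

/-! ### Zeros of proper polynomial self-maps, by commutative algebra -/

open MvPolynomial in
/-- A polynomial function on an irreducible affine variety over `ℂ` is either constant or omits
only countably many values. -/
theorem MvPolynomial.exists_sub_C_mem_or_countable_omitted {n : ℕ}
    (P : Ideal (MvPolynomial (Fin n) ℂ)) [hP : P.IsPrime] (b : MvPolynomial (Fin n) ℂ) :
    (∃ c, b - C c ∈ P) ∨ {c : ℂ | ∀ z ∈ zeroLocus ℂ P, eval z b ≠ c}.Countable := by
  let B := MvPolynomial (Fin n) ℂ ⧸ P
  let F := FractionRing B
  let x : F := algebraMap B F (Ideal.Quotient.mk P b)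
  have hinj : Function.Injective (algebraMap B F) := IsFractionRing.injective B F
  by_cases hx : IsAlgebraic ℂ x
  · left
    obtain ⟨c, hc⟩ := (IsAlgClosed.algebraMap_bijective_of_isIntegral
      (k := ℂ) (K := integralClosure ℂ F)).2 ⟨x, hx.isIntegral⟩
    refine ⟨c, ?_⟩
    rw [← Ideal.Quotient.eq_zero_iff_mem, map_sub, sub_eq_zero]
    apply hinj
    have := congrArg Subtype.val hc
    change _ = x at this
    change x = _
    rw [← this]
    rfl
  · right
    -- Partial fractions: the elements `1 / (x - c)` are linearly independent over `ℂ`. Those with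
    -- `c` omitted lie in `B`, which has countable dimension.
    have hli := Transcendental.linearIndependent_sub_inv (F := ℂ) (E := F) (x := x) hx
    set S := {c : ℂ | ∀ z ∈ zeroLocus ℂ P, eval z b ≠ c}
    have hli' : LinearIndependent ℂ (fun c : S => (x - algebraMap ℂ F c)⁻¹) :=
      hli.comp _ Subtype.val_injective
    let φ : B →ₗ[ℂ] F := (IsScalarTower.toAlgHom ℂ B F).toLinearMap
    have hmem : ∀ c : S, (x - algebraMap ℂ F c)⁻¹ ∈ LinearMap.range φ := by
      rintro ⟨c, hc⟩
      -- By the Nullstellensatz, a maximal ideal containing `b - c` would be a point of the variety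
      -- where `b` takes the value `c`.
      have hu : IsUnit (Ideal.Quotient.mk P (b - C c)) := by
        by_contra hu
        obtain ⟨M, hM, hbM⟩ := exists_max_ideal_of_mem_nonunits hu
        have hM' : (M.comap (Ideal.Quotient.mk P)).IsMaximal :=
          Ideal.comap_isMaximal_of_surjective _ Ideal.Quotient.mk_surjective
        obtain ⟨z, hz⟩ := isMaximal_iff_eq_vanishingIdeal_singleton.1 hM'
        refine hc z ?_ ?_
        · intro p hp
          have : p ∈ M.comap (Ideal.Quotient.mk P) := by
            rw [Ideal.mem_comap, Ideal.Quotient.eq_zero_iff_mem.2 hp]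
            exact M.zero_mem
          rw [hz] at this
          exact (mem_vanishingIdeal_singleton_iff _ _).1 this
        · have : b - C c ∈ M.comap (Ideal.Quotient.mk P) := hbM
          rw [hz] at this
          have := (mem_vanishingIdeal_singleton_iff _ _).1 this
          simpa [sub_eq_zero] using this
      obtain ⟨u, hu⟩ := hu
      refine ⟨(↑u⁻¹ : B), ?_⟩
      have h1 : x - algebraMap ℂ F c = algebraMap B F (u : B) := by
        rw [hu, map_sub, map_sub]
        rfl
      rw [h1]
      change algebraMap B F (↑u⁻¹ : B) = _
      refine eq_inv_of_mul_eq_one_left ?_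
      rw [← map_mul, u.inv_mul, map_one]
    have hle : Module.rank ℂ (LinearMap.range φ) ≤ Cardinal.aleph0 := by
      refine (rank_range_le φ).trans ?_
      refine (LinearMap.rank_le_of_surjective (Ideal.Quotient.mkₐ ℂ P).toLinearMap
        (Ideal.Quotient.mkₐ_surjective ℂ P)).trans ?_
      rw [MvPolynomial.rank_eq]
      exact Cardinal.mk_le_aleph0
    have hli'' : LinearIndependent ℂ
        (fun c : S => (⟨_, hmem c⟩ : LinearMap.range φ)) :=
      LinearIndependent.of_comp (LinearMap.range φ).subtype hli'
    have := (hli''.cardinal_le_rank).trans hle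
    exact Set.countable_coe_iff.1 (Cardinal.mk_le_aleph0_iff.1 this)

open MvPolynomial in
/-- A proper polynomial self-map of `ℂⁿ` has a zero. -/
theorem MvPolynomial.exists_forall_eval_eq_zero_of_proper {n : ℕ}
    (h : Fin n → MvPolynomial (Fin n) ℂ)
    (hp : ∀ M : ℝ, ∃ R : ℝ, ∀ z : Fin n → ℂ, (∀ i, ‖eval z (h i)‖ ≤ M) → ‖z‖ ≤ R) :
    ∃ z, ∀ i, eval z (h i) = 0 := by
  by_contra! hne
  -- the norm of `h` is bounded below
  obtain ⟨r, hr0, hr⟩ : ∃ r > 0, ∀ z, ∃ i, r ≤ ‖eval z (h i)‖ := by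
    have hcont : Continuous fun z : Fin n → ℂ => fun i => eval z (h i) :=
      continuous_pi fun i => MvPolynomial.continuous_eval _
    obtain ⟨R, hR⟩ := hp 1
    by_cases hRn : (Metric.closedBall (0 : Fin n → ℂ) R).Nonempty
    · obtain ⟨z₁, -, hz₁⟩ := (isCompact_closedBall (0 : Fin n → ℂ) R).exists_isMinOn hRn
        hcont.norm.continuousOn
      have hpos : 0 < ‖fun i => eval z₁ (h i)‖ := by
        obtain ⟨i, hi⟩ := hne z₁
        exact (norm_pos_iff.2 hi).trans_le (norm_le_pi_norm (fun i => eval z₁ (h i)) i)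
      refine ⟨min (‖fun i => eval z₁ (h i)‖ / 2) 1, by positivity, fun z => ?_⟩
      by_contra! hz
      have hzR := hR z fun i => ((hz i).trans_le (min_le_right _ _)).le
      have h1 := isMinOn_iff.1 hz₁ z (by simpa using hzR)
      have h2 : ‖fun i => eval z (h i)‖ ≤ ‖fun i => eval z₁ (h i)‖ / 2 :=
        (pi_norm_le_iff_of_nonneg (by positivity)).2
          fun i => ((hz i).trans_le (min_le_left _ _)).le
      linarith
    · refine ⟨1, one_pos, fun z => ?_⟩
      by_contra! hz
      exact hRn ⟨z, by simpa using hR z fun i => (hz i).le⟩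
  have hdim : ringKrullDim (MvPolynomial (Fin n) ℂ) = n := by simp
  have : FiniteRingKrullDim (MvPolynomial (Fin n) ℂ) := by
    rw [finiteRingKrullDim_iff_ne_bot_and_top, hdim]
    exact ⟨WithBot.natCast_ne_bot n, fun h => ENat.natCast_ne_top n (WithBot.coe_injective h)⟩
  -- The preimage under `h` of the line through `0` and `c = h(z₀)` is cut out by `n - 1` equations.
  -- As `m` has height `n`, Krull's height theorem makes the component `P` through `z₀` larger than
  -- a point.
  obtain ⟨m, hm, hmh⟩ := Ideal.exists_isMaximal_height (R := MvPolynomial (Fin n) ℂ)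
  rw [hdim] at hmh
  have hmh' : m.height = n := by exact_mod_cast hmh
  obtain ⟨z₀, hz₀⟩ := isMaximal_iff_eq_vanishingIdeal_singleton.1 hm
  obtain ⟨j, hj⟩ := hne z₀
  set c : Fin n → ℂ := fun i => eval z₀ (h i) with hc
  classical
  let s : Finset (MvPolynomial (Fin n) ℂ) :=
    (Finset.univ.erase j).image fun i => C (c j) * h i - C (c i) * h j
  have hs : s.card < n := by
    refine Finset.card_image_le.trans_lt ?_
    rw [Finset.card_erase_of_mem (Finset.mem_univ j), Finset.card_univ, Fintype.card_fin]
    have := j.pos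
    omega
  have hsm : Ideal.span (s : Set (MvPolynomial (Fin n) ℂ)) ≤ m := by
    rw [Ideal.span_le, hz₀]
    intro p hp
    obtain ⟨i, -, rfl⟩ := Finset.mem_image.1 (Finset.mem_coe.1 hp)
    refine (mem_vanishingIdeal_singleton_iff _ _).2 ?_
    simp [hc, mul_comm]
  obtain ⟨P, hPmin, hPm⟩ := Ideal.exists_minimalPrimes_le hsm
  have hPp : P.IsPrime := hPmin.1.1
  have hPne : P ≠ m := by
    rintro rfl
    have := Ideal.height_le_card_of_mem_minimalPrimes_span_finset hPmin
    rw [hmh'] at this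
    exact absurd (by exact_mod_cast this) (not_le.2 hs)
  have hV : ∀ z ∈ zeroLocus ℂ P, ∀ i, eval z (h i) = c i / c j * eval z (h j) := by
    intro z hz i
    by_cases hij : i = j
    · subst hij
      rw [div_self hj, one_mul]
    · have : C (c j) * h i - C (c i) * h j ∈ P :=
        hPmin.1.2 (Ideal.subset_span (Finset.mem_coe.2 (Finset.mem_image.2
          ⟨i, by simp [hij], rfl⟩)))
      have : c j * eval z (h i) = c i * eval z (h j) := by
        simpa [sub_eq_zero] using hz _ this
      rw [div_mul_eq_mul_div, eq_div_iff (show c j ≠ 0 from hj), mul_comm, this]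
  rcases exists_sub_C_mem_or_countable_omitted P (h j) with ⟨a, ha⟩ | hcount
  -- If `h j` is constant on the component, so is `h`, and properness bounds the component. Each
  -- coordinate then omits uncountably many values, hence is constant, and the component is a point
  -- after all.
  · have hja : ∀ z ∈ zeroLocus ℂ P, eval z (h j) = a := by
      intro z hz
      have := hz _ ha
      simpa [sub_eq_zero] using this
    obtain ⟨R, hR⟩ := hp (‖c‖ / ‖c j‖ * ‖a‖)
    have hbdd : ∀ z ∈ zeroLocus ℂ P, ‖z‖ ≤ R := by
      intro z hz
      refine hR z fun i => ?_
      rw [hV z hz i, hja z hz, norm_mul, norm_div]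
      gcongr
      exact norm_le_pi_norm c i
    have hconst : ∀ i, ∃ b, X i - C b ∈ P := by
      intro i
      refine (exists_sub_C_mem_or_countable_omitted P (X i)).resolve_right fun hcount => ?_
      have hd := hcount.dense_compl ℝ
      obtain ⟨w, hw, hw'⟩ := hd.exists_mem_open (isOpen_lt continuous_const continuous_norm)
        (⟨((|R| + 1 : ℝ) : ℂ), by
          simp only [mem_ofPred_eq, Complex.norm_real, Real.norm_eq_abs]
          rw [abs_of_pos (by positivity)]
          linarith [le_abs_self R]⟩ : {w : ℂ | R < ‖w‖}.Nonempty)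
      simp only [mem_compl_iff, mem_ofPred_eq, not_forall, not_not] at hw
      obtain ⟨z, hz, hzw⟩ := hw
      have h1 := hbdd z hz
      have h2 := norm_le_pi_norm z i
      simp only [eval_X] at hzw
      rw [hzw] at h2
      exact absurd (hw'.trans_le h2) (not_lt.2 h1)
    choose b hb using hconst
    have hzb : ∀ z ∈ zeroLocus ℂ P, z = b := by
      intro z hz
      funext i
      have := hz _ (hb i)
      simpa [sub_eq_zero] using this
    have hz₀P : z₀ ∈ zeroLocus ℂ P := by
      intro p hp
      have := hPm hp
      rw [hz₀] at this
      exact (mem_vanishingIdeal_singleton_iff _ _).1 this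
    apply hPne
    rw [hz₀, ← IsPrime.vanishingIdeal_zeroLocus (K := ℂ) P]
    congr 1
    ext z
    refine ⟨fun hz => ?_, fun hz => ?_⟩
    · rw [mem_singleton_iff, hzb z hz, hzb z₀ hz₀P]
    · rw [mem_singleton_iff.1 hz]
      exact hz₀P
  -- Otherwise `h j` takes values arbitrarily close to `0` on the component, and all of `h` is
  -- proportional to `h j` there, against the lower bound `r`.
  · have hd := hcount.dense_compl ℝ
    obtain ⟨w, hw, hw'⟩ := hd.exists_mem_open
      (isOpen_lt (continuous_const.mul continuous_norm) continuous_const)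
      (⟨0, by simpa using hr0⟩ : {w : ℂ | ‖c‖ / ‖c j‖ * ‖w‖ < r}.Nonempty)
    simp only [mem_compl_iff, mem_ofPred_eq, not_forall, not_not] at hw
    obtain ⟨z, hz, hzw⟩ := hw
    obtain ⟨i, hi⟩ := hr z
    rw [hV z hz i, hzw, norm_mul, norm_div] at hi
    have : ‖c i‖ / ‖c j‖ * ‖w‖ ≤ ‖c‖ / ‖c j‖ * ‖w‖ := by
      gcongr
      exact norm_le_pi_norm c i
    exact absurd (hi.trans this) (not_le.2 hw')

/-! ### Growth of polynomial maps near infinity -/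

theorem EuclideanSpace.norm_le_sum_norm {n : ℕ} (z : EuclideanSpace ℂ (Fin n)) :
    ‖z‖ ≤ ∑ i, ‖z i‖ := by
  rw [EuclideanSpace.norm_eq]
  refine Real.sqrt_le_iff.2 ⟨by positivity, ?_⟩
  exact Finset.sum_sq_le_sq_sum_of_nonneg fun i _ => norm_nonneg _

namespace MvPolynomial

theorem eval_smul_of_isHomogeneous {n D : ℕ} {p : MvPolynomial (Fin n) ℂ}
    (hp : p.IsHomogeneous D) (t : ℂ) (z : Fin n → ℂ) :
    eval (t • z) p = t ^ D * eval z p := by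
  rw [eval_eq', eval_eq', Finset.mul_sum]
  refine Finset.sum_congr rfl fun m hm => ?_
  have hd : ∑ i, m i = D := by
    have := hp (mem_support_iff.1 hm)
    rw [Finsupp.weight_apply, Finsupp.sum_fintype _ _ (by simp)] at this
    simpa using this
  simp only [Pi.smul_apply, smul_eq_mul, mul_pow, Finset.prod_mul_distrib]
  rw [Finset.prod_pow_eq_pow_sum, hd]
  ring

theorem exists_norm_eval_le {n D : ℕ} {p : MvPolynomial (Fin n) ℂ} (hp : p.totalDegree ≤ D) :
    ∃ C : ℝ, 0 ≤ C ∧ ∀ z : EuclideanSpace ℂ (Fin n), 1 ≤ ‖z‖ →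
      ‖eval z.ofLp p‖ ≤ C * ‖z‖ ^ D := by
  refine ⟨∑ m ∈ p.support, ‖coeff m p‖, by positivity, fun z hz => ?_⟩
  rw [eval_eq', Finset.sum_mul]
  refine norm_sum_le_of_le _ fun m hm => ?_
  rw [norm_mul]
  gcongr
  rw [norm_prod]
  calc ∏ i, ‖z.ofLp i ^ m i‖ ≤ ∏ i, ‖z‖ ^ m i := by
        refine Finset.prod_le_prod (fun i _ => norm_nonneg _) fun i _ => ?_
        rw [norm_pow]
        gcongr
        exact PiLp.norm_apply_le z i
    _ = ‖z‖ ^ ∑ i, m i := Finset.prod_pow_eq_pow_sum _ _ _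
    _ ≤ ‖z‖ ^ D := by
        refine pow_le_pow_right₀ hz (le_trans ?_ hp)
        have := le_totalDegree hm
        rwa [Finsupp.sum_fintype _ _ (by simp)] at this

theorem totalDegree_sub_homogeneousComponent_le {n D : ℕ} {p : MvPolynomial (Fin n) ℂ}
    (hp : p.totalDegree ≤ D) : (p - homogeneousComponent D p).totalDegree ≤ D - 1 := by
  refine Finset.sup_le fun m hm => ?_
  change m.degree ≤ D - 1
  rw [mem_support_iff, coeff_sub, coeff_homogeneousComponent] at hm
  split_ifs at hm with h
  · simp at hm
  · rw [sub_zero] at hm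
    have := (le_totalDegree (mem_support_iff.2 hm)).trans hp
    change m.degree ≤ D at this
    omega

theorem totalDegree_pderiv_le {n D : ℕ} {p : MvPolynomial (Fin n) ℂ}
    (hp : p.totalDegree ≤ D) (i : Fin n) : (pderiv i p).totalDegree ≤ D - 1 := by
  refine Finset.sup_le fun m hm => ?_
  change m.degree ≤ D - 1
  rw [mem_support_iff, coeff_pderiv] at hm
  have := (le_totalDegree (mem_support_iff.2 (left_ne_zero_of_mul hm))).trans hp
  change (m + Finsupp.single i 1).degree ≤ D at this
  rw [map_add, Finsupp.degree_single] at this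
  omega

theorem hasFDerivAt_eval {n : ℕ} (p : MvPolynomial (Fin n) ℂ) (z : EuclideanSpace ℂ (Fin n)) :
    HasFDerivAt (fun z : EuclideanSpace ℂ (Fin n) => eval z.ofLp p)
      (∑ i, eval z.ofLp (pderiv i p) • (EuclideanSpace.proj i : EuclideanSpace ℂ (Fin n) →L[ℂ] ℂ))
      z := by
  induction p using MvPolynomial.induction_on with
  | C a =>
    simp only [eval_C]
    exact (hasFDerivAt_const a z).congr_fderiv (by ext v; simp)
  | add p q hp hq =>
    simp only [map_add]
    exact (hp.add hq).congr_fderiv (by ext v; simp [add_mul, Finset.sum_add_distrib])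
  | mul_X p j hp =>
    have hX : HasFDerivAt (fun z : EuclideanSpace ℂ (Fin n) => z.ofLp j)
      (EuclideanSpace.proj j : EuclideanSpace ℂ (Fin n) →L[ℂ] ℂ) z :=
      (EuclideanSpace.proj j : EuclideanSpace ℂ (Fin n) →L[ℂ] ℂ).hasFDerivAt
    simp only [map_mul, eval_X]
    refine (hp.mul hX).congr_fderiv ?_
    ext v
    have hsum : ∑ i, eval z.ofLp p * eval z.ofLp (pderiv i (X j)) * v i =
        eval z.ofLp p * v j := by
      rw [Finset.sum_eq_single j]
      · simp
      · intro b _ hb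
        rw [pderiv_X_of_ne hb.symm]
        simp
      · simp
    simp only [pderiv_mul, map_add, map_mul, eval_X, FunLike.coe_sum, FunLike.coe_add,
      FunLike.coe_smul, Pi.add_apply, Finset.sum_apply, Pi.smul_apply, smul_eq_mul, add_mul,
      Finset.sum_add_distrib, Finset.mul_sum]
    rw [add_comm]
    congr 1
    · exact Finset.sum_congr rfl fun i _ => by ring
    · exact hsum.symm

/-- The self-map of `ℂⁿ` with components the polynomials `P i`. -/
def evalMap {n : ℕ} (P : Fin n → MvPolynomial (Fin n) ℂ) (z : EuclideanSpace ℂ (Fin n)) :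
    EuclideanSpace ℂ (Fin n) :=
  WithLp.toLp 2 fun i => eval z.ofLp (P i)

section evalMap

variable {n : ℕ} (P : Fin n → MvPolynomial (Fin n) ℂ)

theorem evalMap_apply (z : EuclideanSpace ℂ (Fin n)) (i : Fin n) :
    evalMap P z i = eval z.ofLp (P i) := rfl

theorem contDiff_evalMap : ContDiff ℂ 1 (evalMap P) := by
  rw [contDiff_euclidean]
  intro i
  simp only [evalMap_apply]
  induction P i using MvPolynomial.induction_on with
  | C a => simpa using contDiff_const
  | add p q hp hq => simpa only [map_add] using hp.add hq
  | mul_X p j hp =>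
    simp only [map_mul, eval_X]
    exact hp.mul (EuclideanSpace.proj j : EuclideanSpace ℂ (Fin n) →L[ℂ] ℂ).contDiff

theorem continuous_evalMap : Continuous (evalMap P) := (contDiff_evalMap P).continuous

theorem fderiv_evalMap_apply (z v : EuclideanSpace ℂ (Fin n)) (i : Fin n) :
    fderiv ℂ (evalMap P) z v i = ∑ j, eval z.ofLp (pderiv j (P i)) * v j := by
  have h := ((contDiff_evalMap P).differentiable one_ne_zero z).hasFDerivAt
  have h1 := (EuclideanSpace.proj i : EuclideanSpace ℂ (Fin n) →L[ℂ] ℂ).hasFDerivAt.comp z h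
  have h2 := h1.unique (hasFDerivAt_eval (P i) z)
  have := DFunLike.congr_fun h2 v
  simpa using this

theorem exists_norm_evalMap_le {D : ℕ} (hP : ∀ i, (P i).totalDegree ≤ D) :
    ∃ C : ℝ, 0 ≤ C ∧ ∀ z : EuclideanSpace ℂ (Fin n), 1 ≤ ‖z‖ →
      ‖evalMap P z‖ ≤ C * ‖z‖ ^ D := by
  choose C hC0 hC using fun i => exists_norm_eval_le (hP i)
  refine ⟨∑ i, C i, Finset.sum_nonneg fun i _ => hC0 i, fun z hz => ?_⟩
  refine (EuclideanSpace.norm_le_sum_norm _).trans ?_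
  rw [Finset.sum_mul]
  exact Finset.sum_le_sum fun i _ => hC i z hz

theorem exists_norm_fderiv_evalMap_le {D : ℕ} (hP : ∀ i, (P i).totalDegree ≤ D) :
    ∃ C : ℝ, 0 ≤ C ∧ ∀ z : EuclideanSpace ℂ (Fin n), 1 ≤ ‖z‖ →
      ‖fderiv ℂ (evalMap P) z‖ ≤ C * ‖z‖ ^ (D - 1) := by
  choose C hC0 hC using fun i j => exists_norm_eval_le (totalDegree_pderiv_le (hP i) j)
  have hnn : 0 ≤ ∑ i, ∑ j, C i j :=
    Finset.sum_nonneg fun i _ => Finset.sum_nonneg fun j _ => hC0 i j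
  refine ⟨∑ i, ∑ j, C i j, hnn, fun z hz => ?_⟩
  refine ContinuousLinearMap.opNorm_le_bound _ (by positivity) fun v => ?_
  refine (EuclideanSpace.norm_le_sum_norm _).trans ?_
  simp only [Finset.sum_mul]
  refine Finset.sum_le_sum fun i _ => ?_
  rw [fderiv_evalMap_apply]
  refine norm_sum_le_of_le _ fun j _ => ?_
  rw [norm_mul]
  gcongr
  · exact mul_nonneg (hC0 i j) (by positivity)
  · exact hC i j z hz
  · exact PiLp.norm_apply_le v j

theorem det_fderiv_evalMap (z : EuclideanSpace ℂ (Fin n)) :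
    (fderiv ℂ (evalMap P) z).det =
      eval z.ofLp (Matrix.det (Matrix.of fun i j => pderiv j (P i))) := by
  rw [ContinuousLinearMap.det,
    ← LinearMap.det_toMatrix (EuclideanSpace.basisFun (Fin n) ℂ).toBasis, RingHom.map_det]
  congr 1
  ext i j
  simp [LinearMap.toMatrix_apply, fderiv_evalMap_apply]

/-- The homogeneous part of degree `polyMapDegree P` of the polynomial map `P`. -/
def topPart (i : Fin n) : MvPolynomial (Fin n) ℂ :=
  homogeneousComponent (polyMapDegree P) (P i)

theorem totalDegree_le_polyMapDegree (i : Fin n) : (P i).totalDegree ≤ polyMapDegree P :=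
  Finset.le_sup (f := fun i => (P i).totalDegree) (Finset.mem_univ i)

theorem evalMap_topPart_smul (t : ℂ) (z : EuclideanSpace ℂ (Fin n)) :
    evalMap (topPart P) (t • z) = t ^ polyMapDegree P • evalMap (topPart P) z := by
  ext i
  exact eval_smul_of_isHomogeneous (homogeneousComponent_isHomogeneous _ _) t z.ofLp

theorem exists_norm_evalMap_sub_topPart_le :
    ∃ C : ℝ, 0 ≤ C ∧ ∀ z : EuclideanSpace ℂ (Fin n), 1 ≤ ‖z‖ →
      ‖evalMap P z - evalMap (topPart P) z‖ ≤ C * ‖z‖ ^ (polyMapDegree P - 1) := by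
  obtain ⟨C, hC0, hC⟩ := exists_norm_evalMap_le (fun i => P i - topPart P i)
    fun i => totalDegree_sub_homogeneousComponent_le (totalDegree_le_polyMapDegree P i)
  refine ⟨C, hC0, fun z hz => ?_⟩
  convert! hC z hz using 2
  ext i
  simp [evalMap_apply]

theorem exists_evalMap_topPart_ne_zero (hP : 0 < polyMapDegree P) :
    ∃ z, evalMap (topPart P) z ≠ 0 := by
  by_contra! h
  have h0 : ∀ i, topPart P i = 0 := by
    intro i
    refine MvPolynomial.funext fun z => ?_
    rw [map_zero]
    exact congrArg (fun w : EuclideanSpace ℂ (Fin n) => w i) (h (WithLp.toLp 2 z))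
  have : polyMapDegree P ≤ polyMapDegree P - 1 := by
    refine Finset.sup_le fun i _ => ?_
    have := totalDegree_sub_homogeneousComponent_le (totalDegree_le_polyMapDegree P i)
    rwa [show homogeneousComponent (polyMapDegree P) (P i) = 0 from h0 i, sub_zero] at this
  omega

theorem eval_cons_zero_homogenizeAt {D : ℕ} {p : MvPolynomial (Fin n) ℂ}
    (hp : p.totalDegree ≤ D) (w : Fin n → ℂ) :
    eval (Fin.cons 0 w) (homogenizeAt D p) = eval w (homogeneousComponent D p) := by
  rw [homogenizeAt, homogeneousComponent_apply, map_sum, map_sum, Finset.sum_filter]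
  refine Finset.sum_congr rfl fun m hm => ?_
  have hmD : m.degree ≤ D := (le_totalDegree hm).trans hp
  rw [eval_monomial, Finsupp.prod_fintype _ _ (by simp), Fin.prod_univ_succ]
  simp only [Finsupp.cons_zero, Finsupp.cons_succ, Fin.cons_zero, Fin.cons_succ]
  split_ifs with h
  · rw [eval_monomial, Finsupp.prod_fintype _ _ (by simp), h]
    simp
  · rw [zero_pow (by omega)]
    simp

/-- On the hyperplane at infinity `z₀ = 0` the homogeneous lift reduces to `(0, topPart P)`. This is
how disjointness of the indeterminacy sets becomes a statement about leading parts. -/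
theorem mk_mem_indeterminacySet (hP : 0 < polyMapDegree P) {z : EuclideanSpace ℂ (Fin n)}
    (h : evalMap (topPart P) z = 0)
    (hne : (Fin.cons 0 z.ofLp : Fin (n + 1) → ℂ) ≠ 0) :
    Projectivization.mk ℂ (Fin.cons 0 z.ofLp : Fin (n + 1) → ℂ) hne ∈ indeterminacySet P := by
  obtain ⟨a, ha⟩ := Projectivization.exists_smul_eq_mk_rep ℂ _ hne
  have hrep : (Projectivization.mk ℂ (Fin.cons 0 z.ofLp : Fin (n + 1) → ℂ) hne).rep =
      Fin.cons 0 ((a : ℂ) • z).ofLp := by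
    rw [← ha]
    funext i
    refine Fin.cases ?_ (fun i => ?_) i
    · simp
    · simp [Units.smul_def]
  intro i
  rw [hrep]
  refine Fin.cases ?_ (fun i => ?_) i
  · simp [homogeneousLift, hP.ne']
  · simp only [homogeneousLift, Fin.cons_succ]
    rw [eval_cons_zero_homogenizeAt (totalDegree_le_polyMapDegree P i)]
    change evalMap (topPart P) ((a : ℂ) • z) i = 0
    rw [evalMap_topPart_smul, h]
    simp

theorem evalMap_topPart_ne_zero_or {P Q : Fin n → MvPolynomial (Fin n) ℂ}
    (hP : 0 < polyMapDegree P) (hQ : 0 < polyMapDegree Q)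
    (hd : Disjoint (indeterminacySet P) (indeterminacySet Q)) {z : EuclideanSpace ℂ (Fin n)}
    (hz : z ≠ 0) : evalMap (topPart P) z ≠ 0 ∨ evalMap (topPart Q) z ≠ 0 := by
  by_contra! h
  have hne : (Fin.cons 0 z.ofLp : Fin (n + 1) → ℂ) ≠ 0 := by
    intro h0
    apply hz
    ext i
    simpa using congrFun h0 i.succ
  exact Set.disjoint_left.1 hd (mk_mem_indeterminacySet P hP h.1 hne)
    (mk_mem_indeterminacySet Q hQ h.2 hne)

/-- If the top degree parts of `P` and `Q` have no common zero except the origin, at every point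
near infinity one of the two maps has the full growth. -/
theorem exists_le_norm_evalMap_or {P Q : Fin n → MvPolynomial (Fin n) ℂ}
    (hP : 0 < polyMapDegree P) (hQ : 0 < polyMapDegree Q)
    (hd : Disjoint (indeterminacySet P) (indeterminacySet Q)) :
    ∃ c > 0, ∃ R : ℝ, 1 ≤ R ∧ ∀ z : EuclideanSpace ℂ (Fin n), R ≤ ‖z‖ →
      c * ‖z‖ ^ polyMapDegree P ≤ ‖evalMap P z‖ ∨ c * ‖z‖ ^ polyMapDegree Q ≤ ‖evalMap Q z‖ := by
  obtain ⟨c, hc0, hc⟩ : ∃ c > 0, ∀ u : EuclideanSpace ℂ (Fin n), ‖u‖ = 1 →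
      2 * c ≤ ‖evalMap (topPart P) u‖ ∨ 2 * c ≤ ‖evalMap (topPart Q) u‖ := by
    by_cases hS : (Metric.sphere (0 : EuclideanSpace ℂ (Fin n)) 1).Nonempty
    · obtain ⟨u₀, hu₀, hmin⟩ := (isCompact_sphere (0 : EuclideanSpace ℂ (Fin n)) 1).exists_isMinOn
        hS ((continuous_evalMap (topPart P)).norm.max
          (continuous_evalMap (topPart Q)).norm).continuousOn
      have hu₀' : u₀ ≠ 0 := by
        rintro rfl
        simp at hu₀
      refine ⟨max ‖evalMap (topPart P) u₀‖ ‖evalMap (topPart Q) u₀‖ / 2, ?_, fun u hu => ?_⟩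
      · rcases evalMap_topPart_ne_zero_or hP hQ hd hu₀' with h | h
        · have := lt_max_of_lt_left (c := ‖evalMap (topPart Q) u₀‖) (norm_pos_iff.2 h)
          positivity
        · have := lt_max_of_lt_right (b := ‖evalMap (topPart P) u₀‖) (norm_pos_iff.2 h)
          positivity
      · have := isMinOn_iff.1 hmin u (by simpa using hu)
        rw [mul_div_cancel₀ _ two_ne_zero]
        exact le_max_iff.1 this
    · refine ⟨1, one_pos, fun u hu => (hS ⟨u, by simpa using hu⟩).elim⟩
  have key : ∀ P : Fin n → MvPolynomial (Fin n) ℂ, 0 < polyMapDegree P →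
      ∃ R : ℝ, 1 ≤ R ∧ ∀ z : EuclideanSpace ℂ (Fin n), R ≤ ‖z‖ →
      2 * c ≤ ‖evalMap (topPart P) ((‖z‖⁻¹ : ℂ) • z)‖ →
      c * ‖z‖ ^ polyMapDegree P ≤ ‖evalMap P z‖ := by
    intro P hP
    obtain ⟨C, hC0, hC⟩ := exists_norm_evalMap_sub_topPart_le P
    refine ⟨max 1 (C / c), le_max_left _ _, fun z hz h => ?_⟩
    have hz1 : 1 ≤ ‖z‖ := (le_max_left _ _).trans hz
    have hz0 : 0 < ‖z‖ := by linarith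
    have hzC : C ≤ c * ‖z‖ := by
      have := (le_max_right _ _).trans hz
      rwa [div_le_iff₀ hc0, mul_comm] at this
    rw [evalMap_topPart_smul, norm_smul, norm_pow, norm_inv, Complex.norm_real, norm_norm,
      inv_pow, ← div_eq_inv_mul, le_div_iff₀ (by positivity)] at h
    have h1 := hC z hz1
    have h2 : C * ‖z‖ ^ (polyMapDegree P - 1) ≤ c * ‖z‖ ^ polyMapDegree P := by
      calc C * ‖z‖ ^ (polyMapDegree P - 1) ≤ c * ‖z‖ * ‖z‖ ^ (polyMapDegree P - 1) := by gcongr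
        _ = c * ‖z‖ ^ polyMapDegree P := by
          rw [mul_assoc, ← pow_succ', Nat.sub_add_cancel hP]
    have h3 := norm_sub_norm_le (evalMap (topPart P) z) (evalMap P z)
    rw [norm_sub_rev] at h3
    linarith
  obtain ⟨R, hR1, hR⟩ := key P hP
  obtain ⟨R', hR1', hR'⟩ := key Q hQ
  refine ⟨c, hc0, max R R', hR1.trans (le_max_left _ _), fun z hz => ?_⟩
  have hz0 : ‖z‖ ≠ 0 := by
    have := (le_max_left _ _).trans hz
    linarith
  refine (hc ((‖z‖⁻¹ : ℂ) • z) ?_).imp (hR z ((le_max_left _ _).trans hz))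
    (hR' z ((le_max_right _ _).trans hz))
  rw [norm_smul, norm_inv, Complex.norm_real, norm_norm, inv_mul_cancel₀ hz0]

end evalMap

end MvPolynomial

namespace MvPolynomial

/-- If `P` and `Q` have full growth near infinity in complementary directions and `P w = Q y` with
`w` at bounded distance of `y`, then the common value is at least quadratic in `y`. -/
theorem exists_mul_sq_le_norm_evalMap {n : ℕ} {P Q : Fin n → MvPolynomial (Fin n) ℂ}
    (hP : 1 < polyMapDegree P) (hQ : 1 < polyMapDegree Q)
    (hd : Disjoint (indeterminacySet P) (indeterminacySet Q)) {M : ℝ} (hM : 0 ≤ M) :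
    ∃ κ > 0, ∃ R : ℝ, ∀ y w : EuclideanSpace ℂ (Fin n), R ≤ ‖y‖ → ‖w - y‖ ≤ M →
      evalMap P w = evalMap Q y → κ * ‖y‖ ^ 2 ≤ ‖evalMap P w‖ := by
  obtain ⟨c, hc0, R, hR1, hR⟩ := exists_le_norm_evalMap_or (by omega) (by omega) hd
  obtain ⟨C, hC0, hC⟩ := exists_norm_fderiv_evalMap_le P (totalDegree_le_polyMapDegree P)
  set a := polyMapDegree P
  refine ⟨c / 2, by positivity, max R (max (M + 1) (C * 2 ^ (a - 1) * M / (c / 2))),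
    fun y w hy hwy heq => ?_⟩
  have hyR : R ≤ ‖y‖ := (le_max_left _ _).trans hy
  have hyM : M + 1 ≤ ‖y‖ := ((le_max_left _ _).trans (le_max_right _ _)).trans hy
  have hyC : C * 2 ^ (a - 1) * M ≤ c / 2 * ‖y‖ := by
    have := ((le_max_right _ _).trans (le_max_right _ _)).trans hy
    rwa [div_le_iff₀ (by positivity), mul_comm ‖y‖] at this
  have hy1 : 1 ≤ ‖y‖ := hR1.trans hyR
  have hsq : ∀ {b : ℕ}, 1 < b → c / 2 * ‖y‖ ^ 2 ≤ c / 2 * ‖y‖ ^ b := fun hb => by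
    gcongr
    exact hb
  rcases hR y hyR with h | h
  -- The derivative has degree at most `a - 1`, so a bounded displacement changes `P` by a lower
  -- order term, absorbed by half of `c * ‖y‖ ^ a`.
  · have hseg : ‖evalMap P w - evalMap P y‖ ≤ C * (2 * ‖y‖) ^ (a - 1) * ‖w - y‖ := by
      refine (convex_closedBall y M).norm_image_sub_le_of_norm_fderiv_le (𝕜 := ℂ)
        (fun x _ => (contDiff_evalMap P).differentiable one_ne_zero x) (fun x hx => ?_)
        (Metric.mem_closedBall_self hM) (by simpa [dist_eq_norm] using hwy)
      rw [Metric.mem_closedBall, dist_eq_norm] at hx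
      have h1 : ‖y‖ - ‖x‖ ≤ M := by
        rw [norm_sub_rev] at hx
        exact (norm_sub_norm_le _ _).trans hx
      have h2 : ‖x‖ - ‖y‖ ≤ M := (norm_sub_norm_le _ _).trans hx
      refine (hC x (by linarith)).trans ?_
      gcongr
      linarith
    have h1 : C * (2 * ‖y‖) ^ (a - 1) * ‖w - y‖ ≤ c / 2 * ‖y‖ ^ a := by
      calc C * (2 * ‖y‖) ^ (a - 1) * ‖w - y‖ ≤ C * (2 * ‖y‖) ^ (a - 1) * M := by gcongr
        _ = C * 2 ^ (a - 1) * M * ‖y‖ ^ (a - 1) := by rw [mul_pow]; ring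
        _ ≤ c / 2 * ‖y‖ * ‖y‖ ^ (a - 1) := by gcongr
        _ = c / 2 * ‖y‖ ^ a := by
          rw [mul_assoc, ← pow_succ', Nat.sub_add_cancel (by omega)]
    have h2 := norm_sub_norm_le (evalMap P y) (evalMap P w)
    rw [norm_sub_rev] at h2
    have := hsq hP
    linarith
  · rw [heq]
    refine (hsq hQ).trans (le_trans ?_ h)
    gcongr
    linarith

end MvPolynomial

/-! ### Polynomial automorphisms: degree of the inverse, a periodic point, the Jacobian -/

namespace PolynomialAutomorphism

open MvPolynomial

variable {n : ℕ} (f : PolynomialAutomorphism n)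

theorem symm_toFun_toFun (z : EuclideanSpace ℂ (Fin n)) : f.symm.toFun (f.toFun z) = z := by
  ext i
  change eval (fun j => eval z.ofLp (f.map j)) (f.inv i) = z i
  have h := congrArg (eval z.ofLp) (f.inv_comp_map i)
  rw [eval_X] at h
  rw [← h]
  simp only [← coe_aeval_eq_eval, RingHom.coe_coe]
  rw [aeval_bind₁]

theorem toFun_symm_toFun (z : EuclideanSpace ℂ (Fin n)) : f.toFun (f.symm.toFun z) = z :=
  f.symm.symm_toFun_toFun z

theorem contDiff_toFun : ContDiff ℂ 1 f.toFun := contDiff_evalMap f.map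

theorem differentiable_toFun : Differentiable ℂ f.toFun :=
  f.contDiff_toFun.differentiable one_ne_zero

theorem continuous_toFun : Continuous f.toFun := f.contDiff_toFun.continuous

/-- A polynomial automorphism as a homeomorphism of `ℂⁿ`. -/
def homeomorph : EuclideanSpace ℂ (Fin n) ≃ₜ EuclideanSpace ℂ (Fin n) where
  toFun := f.toFun
  invFun := f.symm.toFun
  left_inv := f.symm_toFun_toFun
  right_inv := f.toFun_symm_toFun
  continuous_toFun := f.continuous_toFun
  continuous_invFun := f.symm.continuous_toFun

theorem fderiv_symm_comp_fderiv (z : EuclideanSpace ℂ (Fin n)) :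
    (fderiv ℂ f.symm.toFun (f.toFun z)).comp (fderiv ℂ f.toFun z) =
      ContinuousLinearMap.id ℂ _ := by
  rw [← fderiv_comp z (f.symm.differentiable_toFun _) (f.differentiable_toFun _),
    show f.symm.toFun ∘ f.toFun = id from funext f.symm_toFun_toFun, fderiv_id]

/-- An inverse of degree at most one has constant derivative. By the chain rule so has `f`, which
then grows at most linearly, whereas its leading part forces growth `t ^ d` along some ray. -/
theorem one_lt_polyMapDegree_inv (hf : 1 < polyMapDegree f.map) : 1 < polyMapDegree f.inv := by
  by_contra! hinv
  have hB : ∀ w, fderiv ℂ f.symm.toFun w = fderiv ℂ f.symm.toFun 0 := by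
    intro w
    ext v i
    change fderiv ℂ (evalMap f.inv) w v i = fderiv ℂ (evalMap f.inv) 0 v i
    rw [fderiv_evalMap_apply, fderiv_evalMap_apply]
    refine Finset.sum_congr rfl fun j _ => ?_
    have h0 := totalDegree_pderiv_le ((totalDegree_le_polyMapDegree f.inv i).trans hinv) j
    rw [totalDegree_eq_zero_iff_eq_C.1 (Nat.le_zero.1 h0), eval_C, eval_C]
  have hA : ∀ z, fderiv ℂ f.toFun z = fderiv ℂ f.toFun 0 := by
    intro z
    have h1 := f.symm.fderiv_symm_comp_fderiv (f.toFun z)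
    rw [f.symm_toFun_toFun, hB] at h1
    have h2 := f.fderiv_symm_comp_fderiv 0
    rw [hB] at h2
    calc fderiv ℂ f.toFun z = (fderiv ℂ f.toFun z).comp
          ((fderiv ℂ f.symm.toFun 0).comp (fderiv ℂ f.toFun 0)) := by
          rw [h2, ContinuousLinearMap.comp_id]
      _ = fderiv ℂ f.toFun 0 := by
          rw [← ContinuousLinearMap.comp_assoc]
          exact (congrArg (fun L : EuclideanSpace ℂ (Fin n) →L[ℂ] EuclideanSpace ℂ (Fin n) =>
            L.comp (fderiv ℂ f.toFun 0)) h1).trans (ContinuousLinearMap.id_comp _)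
  have hgrow : ∀ z, ‖f.toFun z - f.toFun 0‖ ≤ ‖fderiv ℂ f.toFun 0‖ * ‖z‖ := by
    intro z
    simpa using convex_univ.norm_image_sub_le_of_norm_fderiv_le (𝕜 := ℂ)
      (fun x _ => f.differentiable_toFun x) (fun x _ => (congrArg norm (hA x)).le)
      (mem_univ 0) (mem_univ z)
  obtain ⟨z, hz⟩ := exists_evalMap_topPart_ne_zero f.map (by omega)
  obtain ⟨C, hC0, hC⟩ := exists_norm_evalMap_sub_topPart_le f.map
  set d := polyMapDegree f.map
  have hz0 : z ≠ 0 := by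
    rintro rfl
    apply hz
    have := evalMap_topPart_smul f.map 0 0
    rw [smul_zero, zero_pow (by omega), zero_smul] at this
    exact this
  have hzpos : 0 < ‖z‖ := norm_pos_iff.2 hz0
  set N := ‖evalMap (topPart f.map) z‖
  have hN : 0 < N := norm_pos_iff.2 hz
  set B := ‖fderiv ℂ f.toFun 0‖ + ‖f.toFun 0‖ + C
  -- The first entry puts `t • z` outside the unit ball, where the estimates hold; the second
  -- violates the bound `t * N ≤ B * ‖z‖ ^ (d - 1)` derived below.
  set t : ℝ := max (1 / ‖z‖) (B * ‖z‖ ^ (d - 1) / N + 1)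
  have ht1 : 1 ≤ t * ‖z‖ := by
    rw [← div_le_iff₀ hzpos]
    exact le_max_left _ _
  have ht0 : 0 < t := lt_max_of_lt_left (by positivity)
  have htz : ‖(t : ℂ) • z‖ = t * ‖z‖ := by
    rw [norm_smul, Complex.norm_real, Real.norm_of_nonneg ht0.le]
  have h1 := hC ((t : ℂ) • z) (htz ▸ ht1)
  have h2 := hgrow ((t : ℂ) • z)
  rw [htz] at h1 h2
  have h3 : ‖evalMap (topPart f.map) ((t : ℂ) • z)‖ = t ^ d * N := by
    rw [evalMap_topPart_smul, norm_smul, norm_pow, Complex.norm_real, Real.norm_of_nonneg ht0.le]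
  have h4 : t * ‖z‖ ≤ (t * ‖z‖) ^ (d - 1) := le_self_pow₀ ht1 (by omega)
  have h5 : t ^ d * N ≤ B * (t * ‖z‖) ^ (d - 1) := by
    have h6 := norm_sub_norm_le (evalMap (topPart f.map) ((t : ℂ) • z)) (f.toFun ((t : ℂ) • z))
    rw [norm_sub_rev, h3] at h6
    have h7 := norm_sub_norm_le (f.toFun ((t : ℂ) • z)) (f.toFun 0)
    have h8 : ‖fderiv ℂ f.toFun 0‖ * (t * ‖z‖) ≤ ‖fderiv ℂ f.toFun 0‖ * (t * ‖z‖) ^ (d - 1) := by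
      gcongr
    have h9 : ‖f.toFun 0‖ * 1 ≤ ‖f.toFun 0‖ * (t * ‖z‖) ^ (d - 1) := by
      gcongr
      exact ht1.trans h4
    change ‖f.toFun _ - _‖ ≤ _ at h1
    simp only [B, add_mul]
    linarith
  have h6 : t * N ≤ B * ‖z‖ ^ (d - 1) := by
    refine le_of_mul_le_mul_left ?_ (pow_pos ht0 (d - 1))
    calc t ^ (d - 1) * (t * N) = t ^ d * N := by
          rw [← mul_assoc, ← pow_succ, Nat.sub_add_cancel (by omega)]
      _ ≤ B * (t * ‖z‖) ^ (d - 1) := h5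
      _ = _ := by rw [mul_pow]; ring
  rw [← le_div_iff₀ hN] at h6
  have := le_max_right (1 / ‖z‖) (B * ‖z‖ ^ (d - 1) / N + 1)
  linarith

variable {f} in
theorem IsRegular.symm (hf : f.IsRegular) : f.symm.IsRegular :=
  ⟨f.one_lt_polyMapDegree_inv hf.1, hf.2.symm⟩

variable {f} in
/-- A regular polynomial automorphism has a point of period dividing two. -/
theorem IsRegular.exists_toFun_toFun_eq (hf : f.IsRegular) : ∃ z, f.toFun (f.toFun z) = z := by
  -- A zero of `f - f⁻¹` satisfies `f(f(z)) = z`. Only the properness of this map needs proof.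
  obtain ⟨z, hz⟩ := exists_forall_eval_eq_zero_of_proper (fun i => f.map i - f.inv i) (by
    intro M
    obtain ⟨c, hc0, R, hR1, hR⟩ := exists_le_norm_evalMap_or (zero_lt_one.trans hf.1)
      (zero_lt_one.trans hf.symm.1) hf.2
    have hM : 0 ≤ n * |M| := by positivity
    obtain ⟨κ, hκ, R₁, hR₁⟩ := exists_mul_sq_le_norm_evalMap hf.symm.1 hf.1 hf.2.symm hM
    obtain ⟨κ', hκ', R₂, hR₂⟩ := exists_mul_sq_le_norm_evalMap hf.1 hf.symm.1 hf.2 hM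
    set T := max R (max (1 / c) (max (1 / κ) (max R₁ (max (1 / κ') R₂))))
    refine ⟨T, fun z₀ hz₀ => ?_⟩
    by_contra! hT
    set z : EuclideanSpace ℂ (Fin n) := WithLp.toLp 2 z₀
    have hzT : T < ‖z‖ := hT.trans_le (by
      refine (pi_norm_le_iff_of_nonneg (norm_nonneg _)).2 fun i => ?_
      exact PiLp.norm_apply_le z i)
    simp only [T, max_lt_iff] at hzT
    obtain ⟨hT1, hT2, hT3, hT4, hT5, hT6⟩ := hzT
    have hz1 : 1 < ‖z‖ := hR1.trans_lt hT1
    rw [div_lt_iff₀ hc0] at hT2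
    rw [div_lt_iff₀ hκ] at hT3
    rw [div_lt_iff₀ hκ'] at hT5
    set w := f.toFun z
    set y := f.symm.toFun z
    have hwy : ‖w - y‖ ≤ n * |M| := by
      refine (EuclideanSpace.norm_le_sum_norm _).trans ?_
      refine (Finset.sum_le_card_nsmul _ _ |M| fun i _ => ?_).trans (by simp)
      have := (hz₀ i).trans (le_abs_self M)
      rw [map_sub] at this
      exact this
    have hyw : ‖y - w‖ ≤ n * |M| := by rwa [norm_sub_rev]
    have e1 : evalMap f.inv w = z := f.symm_toFun_toFun z
    have e2 : evalMap f.map y = z := f.toFun_symm_toFun z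
    have hgrow : ∀ {d : ℕ}, 1 < d → ‖z‖ ≤ c * ‖z‖ ^ d := fun {d} hd => by
      calc ‖z‖ ≤ ‖z‖ * c * ‖z‖ := by
            nlinarith
        _ = c * ‖z‖ ^ 2 := by ring
        _ ≤ c * ‖z‖ ^ d := by
            gcongr
            exacts [hz1.le, hd]
    -- Say `f` has full growth at `z`, so `‖w‖ ≥ ‖z‖`. Since `f(y) = z = f⁻¹(w)` with `y` near `w`,
    -- `‖z‖` is at least quadratic in `‖w‖`, which is impossible for large `z`. The other case
    -- exchanges `f` and `f⁻¹`.
    rcases hR z hT1.le with h | h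
    · have h1 : ‖z‖ ≤ ‖w‖ := (hgrow hf.1).trans h
      have h2 := hR₂ w y (hT6.le.trans h1) hyw (e2.trans e1.symm)
      rw [e2] at h2
      have h3 : κ' * ‖z‖ ^ 2 ≤ κ' * ‖w‖ ^ 2 := by gcongr
      nlinarith
    · have h1 : ‖z‖ ≤ ‖y‖ := (hgrow hf.symm.1).trans h
      have h2 := hR₁ y w (hT4.le.trans h1) hwy (e1.trans e2.symm)
      rw [show evalMap f.symm.map w = z from e1] at h2
      have h3 : κ * ‖z‖ ^ 2 ≤ κ * ‖y‖ ^ 2 := by gcongr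
      nlinarith)
  refine ⟨WithLp.toLp 2 z, ?_⟩
  have h : f.toFun (WithLp.toLp 2 z) = f.symm.toFun (WithLp.toLp 2 z) := by
    ext i
    have := hz i
    rwa [map_sub, sub_eq_zero] at this
  rw [h, f.toFun_symm_toFun]

theorem isBounded_range_iterate_of_period_two {z : EuclideanSpace ℂ (Fin n)}
    (h : f.toFun (f.toFun z) = z) :
    Bornology.IsBounded (range fun k : ℕ => f.toFun^[k] z) := by
  refine ((Set.finite_singleton (f.toFun z)).insert z).isBounded.subset ?_
  rintro _ ⟨k, rfl⟩
  induction k with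
  | zero => simp
  | succ k ih =>
    simp only [Function.iterate_succ_apply']
    rcases ih with h1 | h1
    · right
      exact congrArg f.toFun h1
    · left
      exact (congrArg f.toFun h1).trans h

variable {f} in
theorem IsRegular.nonempty_K (hf : f.IsRegular) : f.K.Nonempty := by
  obtain ⟨z, hz⟩ := hf.exists_toFun_toFun_eq
  refine ⟨z, f.isBounded_range_iterate_of_period_two hz,
    f.symm.isBounded_range_iterate_of_period_two ?_⟩
  conv_lhs => rw [← hz, f.symm_toFun_toFun, f.symm_toFun_toFun]

theorem det_fderiv_symm_mul_det_fderiv (z : EuclideanSpace ℂ (Fin n)) :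
    f.symm.jacobianDet (f.toFun z) * f.jacobianDet z = 1 := by
  have h := congrArg ContinuousLinearMap.det (f.fderiv_symm_comp_fderiv z)
  simp only [ContinuousLinearMap.det, ContinuousLinearMap.toLinearMap_comp, LinearMap.det_comp] at h
  exact h.trans LinearMap.det_id

theorem jacobianDet_ne_zero (z : EuclideanSpace ℂ (Fin n)) : f.jacobianDet z ≠ 0 :=
  right_ne_zero_of_mul_eq_one (f.det_fderiv_symm_mul_det_fderiv z)

/-- The Jacobian is a polynomial without zeros, hence a unit by the Nullstellensatz, hence a
constant. -/
theorem jacobianDet_eq (z w : EuclideanSpace ℂ (Fin n)) : f.jacobianDet z = f.jacobianDet w := by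
  set J : MvPolynomial (Fin n) ℂ := Matrix.det (Matrix.of fun i j => pderiv j (f.map i))
  have hdet : ∀ z, f.jacobianDet z = eval z.ofLp J := det_fderiv_evalMap f.map
  have hu : IsUnit J := by
    by_contra hu
    obtain ⟨M, hM, hJM⟩ := exists_max_ideal_of_mem_nonunits hu
    obtain ⟨x, hx⟩ := isMaximal_iff_eq_vanishingIdeal_singleton.1 hM
    rw [hx] at hJM
    refine f.jacobianDet_ne_zero (WithLp.toLp 2 x) ?_
    rw [hdet]
    exact (mem_vanishingIdeal_singleton_iff _ _).1 hJM
  obtain ⟨c, -, hc⟩ := isUnit_iff_eq_C_of_isReduced.1 hu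
  rw [hdet, hdet, hc, eval_C, eval_C]

end PolynomialAutomorphism

/-! ### Box dimension from the volume of neighbourhoods -/

section BoxDim

open MeasureTheory Metric Module

/-- Covering numbers are bounded by packing numbers, and the balls of radius `ε / 2` about an
`ε`-separated subset of `A` are disjoint and lie in the `ε`-neighbourhood. -/
theorem externalCoveringNumber_mul_addHaar_ball_le {E : Type*} [NormedAddCommGroup E]
    [NormedSpace ℝ E] [MeasurableSpace E] [BorelSpace E] (μ : Measure E) [μ.IsAddHaarMeasure]
    [FiniteDimensional ℝ E] (A : Set E) {ε : ℝ≥0} (hε : 0 < ε) :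
    (externalCoveringNumber ε A : ℝ≥0∞) * μ (ball 0 (ε / 2)) ≤ μ (thickening ε A) := by
  have hpos : (0 : ℝ) < ε := hε
  have hβ : μ (ball 0 ((ε : ℝ) / 2)) ≠ 0 := (measure_ball_pos μ 0 (by positivity)).ne'
  have hβ' : μ (ball 0 ((ε : ℝ) / 2)) ≠ ⊤ := measure_ball_lt_top.ne
  have key : ∀ C : Set E, C ⊆ A → IsSeparated ε C →
      (C.encard : ℝ≥0∞) ≤ μ (thickening ε A) / μ (ball 0 (ε / 2)) := by
    intro C hCA hC
    rw [ENNReal.le_div_iff_mul_le (Or.inl hβ) (Or.inl hβ'), ← ENNReal.tsum_set_const]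
    calc ∑' _ : C, μ (ball 0 ((ε : ℝ) / 2)) = ∑' x : C, μ (ball (x : E) ((ε : ℝ) / 2)) := by
          simp_rw [Measure.addHaar_ball_center μ]
      _ ≤ μ (⋃ x : C, ball (x : E) ((ε : ℝ) / 2)) := by
          refine tsum_meas_le_meas_iUnion_of_disjoint μ (fun _ => measurableSet_ball) ?_
          intro x y hxy
          refine ball_disjoint_ball ?_
          have h : (ε : ℝ≥0∞) < edist (x : E) y := hC x.2 y.2 (fun h => hxy (Subtype.ext h))
          rw [edist_nndist, ENNReal.coe_lt_coe] at h
          have h' : (ε : ℝ) < dist (x : E) y := h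
          linarith
      _ ≤ μ (thickening ε A) := by
          refine measure_mono (iUnion_subset fun x y hy => ?_)
          exact mem_thickening_iff.2 ⟨x, hCA x.2, (mem_ball.1 hy).trans (by linarith)⟩
  rw [← ENNReal.le_div_iff_mul_le (Or.inl hβ) (Or.inl hβ')]
  refine le_trans (ENat.toENNReal_mono ((externalCoveringNumber_le_coveringNumber ε A).trans
    (coveringNumber_le_packingNumber ε A))) ?_
  simp only [packingNumber, ENat.toENNReal_iSup]
  exact iSup_le fun C => iSup₂_le fun hCA hC => key C hCA hC

theorem NNReal.tendsto_neg_log_nhdsGT_zero :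
    Tendsto (fun ε : ℝ≥0 => -Real.log ε) (𝓝[>] 0) atTop := by
  have h : Tendsto (fun ε : ℝ≥0 => (ε : ℝ)) (𝓝[>] 0) (𝓝[>] 0) := by
    refine tendsto_nhdsWithin_iff.2 ⟨?_, ?_⟩
    · exact (NNReal.continuous_coe.tendsto 0).mono_left nhdsWithin_le_nhds
    · exact eventually_mem_nhdsWithin.mono fun ε hε => hε
  exact tendsto_neg_atBot_atTop.comp (Real.tendsto_log_nhdsGT_zero.comp h)

theorem upperBoxDim_mono {X : Type*} [PseudoEMetricSpace X] {A B : Set X} (h : A ⊆ B) :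
    upperBoxDim A ≤ upperBoxDim B := by
  refine limsup_le_limsup ?_
  filter_upwards [NNReal.tendsto_neg_log_nhdsGT_zero.eventually_gt_atTop 0] with ε hε
  refine EReal.div_le_div_right_of_nonneg (by exact_mod_cast hε.le) ?_
  exact ENNReal.log_le_log_iff.2 (ENat.toENNReal_mono (externalCoveringNumber_mono_set h))

theorem upperBoxDim_le_of_eventually_le {X : Type*} [PseudoEMetricSpace X] {A : Set X} {C t : ℝ}
    (h : ∀ᶠ ε : ℝ≥0 in 𝓝[>] 0, (externalCoveringNumber ε A : ℝ≥0∞) ≤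
      ENNReal.ofReal (Real.exp (C + t * -Real.log ε))) :
    upperBoxDim A ≤ (t : EReal) := by
  have hlim : Tendsto (fun ε : ℝ≥0 => ((C / -Real.log ε + t : ℝ) : EReal)) (𝓝[>] 0)
      (𝓝 (t : EReal)) := by
    refine (continuous_coe_real_ereal.tendsto t).comp ?_
    simpa using (NNReal.tendsto_neg_log_nhdsGT_zero.const_div_atTop C).add_const t
  rw [← hlim.limsup_eq]
  refine limsup_le_limsup ?_
  filter_upwards [NNReal.tendsto_neg_log_nhdsGT_zero.eventually_gt_atTop 0, h] with ε hε hle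
  rw [EReal.div_le_iff_le_mul (by exact_mod_cast hε) (EReal.coe_ne_top _)]
  refine (ENNReal.log_le_log_iff.2 hle).trans ?_
  rw [ENNReal.log_ofReal_of_pos (Real.exp_pos _), Real.log_exp, ← EReal.coe_mul, EReal.coe_le_coe_iff]
  rw [mul_add, mul_div_cancel₀ _ hε.ne', mul_comm t]

/-- If the volume of the `δ / L ^ m`-neighbourhood of `A` decays like `b ^ (-m)`, the upper box
dimension of `A` drops by at least `log b / log L`. -/
theorem upperBoxDim_le_of_measure_thickening_le {E : Type*} [NormedAddCommGroup E]
    [NormedSpace ℝ E] [FiniteDimensional ℝ E] [MeasurableSpace E] [BorelSpace E] (μ : Measure E)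
    [μ.IsAddHaarMeasure] {A : Set E} {δ L b : ℝ} {M : ℝ≥0∞} (hM : M ≠ ⊤) (hL : 1 < L)
    (hb : 1 ≤ b) (hδ : 0 < δ)
    (h : ∀ m : ℕ, ENNReal.ofReal (b ^ m) * μ (thickening (δ / L ^ m) A) ≤ M) :
    upperBoxDim A ≤ ((finrank ℝ E - Real.log b / Real.log L : ℝ) : EReal) := by
  set D := finrank ℝ E
  have hb0 : 0 < b := by linarith
  have hL0 : 0 < L := by linarith
  have hlogL : 0 < Real.log L := Real.log_pos hL
  have hlogb : 0 ≤ Real.log b := Real.log_nonneg hb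
  have hβ : 0 < (μ (ball (0 : E) 1)).toReal :=
    ENNReal.toReal_pos (measure_ball_pos μ 0 one_pos).ne' measure_ball_lt_top.ne
  set β := (μ (ball (0 : E) 1)).toReal
  have hM1 : 0 < M.toReal + 1 := by positivity
  -- The constant collects everything in the logarithm of the covering bound that does not depend on
  -- `ε`. The final `log b` pays for rounding to an integer exponent `m`, and `M.toReal + 1` avoids
  -- the logarithm of zero.
  refine upperBoxDim_le_of_eventually_le (C := Real.log (M.toReal + 1) + D * Real.log 2 -
    Real.log β - Real.log δ * (Real.log b / Real.log L) + Real.log b) ?_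
  have hev : ∀ᶠ ε : ℝ≥0 in 𝓝[>] 0, (ε : ℝ) < δ := by
    have : Tendsto (fun ε : ℝ≥0 => (ε : ℝ)) (𝓝[>] 0) (𝓝 0) :=
      (NNReal.continuous_coe.tendsto 0).mono_left nhdsWithin_le_nhds
    exact this.eventually (gt_mem_nhds hδ)
  filter_upwards [hev, eventually_mem_nhdsWithin] with ε hεδ hε
  have hε' : 0 < ε := hε
  have hεpos : (0 : ℝ) < ε := hε
  -- The scale is bracketed by `δ / L ^ (m + 1) < ε ≤ δ / L ^ m`.
  obtain ⟨m, hm1, hm2⟩ := exists_nat_pow_near_of_lt_one (x := (ε : ℝ) / δ) (y := L⁻¹)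
    (by positivity) ((div_le_one hδ).2 hεδ.le) (by positivity) (inv_lt_one_of_one_lt₀ hL)
  have hle : (ε : ℝ) ≤ δ / L ^ m := by
    rwa [div_le_iff₀ hδ, inv_pow, mul_comm, ← div_eq_mul_inv] at hm2
  have h1 := externalCoveringNumber_mul_addHaar_ball_le μ A hε'
  rw [Measure.addHaar_ball_of_pos μ 0 (by positivity : (0 : ℝ) < (ε : ℝ) / 2)] at h1
  have hball : μ (ball (0 : E) 1) = ENNReal.ofReal β :=
    (ENNReal.ofReal_toReal measure_ball_lt_top.ne).symm
  have h2 : (externalCoveringNumber ε A : ℝ≥0∞) *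
      ENNReal.ofReal (b ^ m * (((ε : ℝ) / 2) ^ D * β)) ≤ ENNReal.ofReal (M.toReal + 1) := by
    calc (externalCoveringNumber ε A : ℝ≥0∞) * ENNReal.ofReal (b ^ m * (((ε : ℝ) / 2) ^ D * β))
        = ENNReal.ofReal (b ^ m) * ((externalCoveringNumber ε A : ℝ≥0∞) *
          (ENNReal.ofReal (((ε : ℝ) / 2) ^ D) * μ (ball (0 : E) 1))) := by
          rw [hball, ENNReal.ofReal_mul (by positivity), ENNReal.ofReal_mul (by positivity)]
          ring
      _ ≤ ENNReal.ofReal (b ^ m) * μ (thickening (δ / L ^ m) A) := by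
          gcongr
          exact h1.trans (measure_mono (thickening_mono hle A))
      _ ≤ M := h m
      _ ≤ ENNReal.ofReal (M.toReal + 1) := by
          rw [← ENNReal.ofReal_toReal hM]
          exact ENNReal.ofReal_le_ofReal (by simp)
  have hpos : 0 < b ^ m * (((ε : ℝ) / 2) ^ D * β) := by positivity
  rw [← ENNReal.le_div_iff_mul_le (Or.inl (by simpa using hpos)) (Or.inl ENNReal.ofReal_ne_top),
    ← ENNReal.ofReal_div_of_pos hpos] at h2
  refine h2.trans (ENNReal.ofReal_le_ofReal ?_)
  rw [← Real.log_le_iff_le_exp (by positivity), Real.log_div hM1.ne' hpos.ne',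
    Real.log_mul (by positivity) (by positivity), Real.log_mul (by positivity) hβ.ne',
    Real.log_pow, Real.log_pow, Real.log_div hεpos.ne' two_ne_zero]
  have h3 : Real.log δ - Real.log ε < (m + 1) * Real.log L := by
    have := Real.log_lt_log (by positivity) hm1
    rw [Real.log_pow, Real.log_inv, Real.log_div hεpos.ne' hδ.ne'] at this
    push_cast at this
    linarith
  have h4 : (Real.log δ - Real.log ε) * (Real.log b / Real.log L) ≤ (m + 1) * Real.log b := by
    calc (Real.log δ - Real.log ε) * (Real.log b / Real.log L)
        ≤ ((m + 1) * Real.log L) * (Real.log b / Real.log L) := by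
          gcongr
      _ = (m + 1) * Real.log b := by field_simp
  linarith

/-- The square appears because the real determinant of a complex linear map is the squared modulus
of its complex determinant. -/
theorem volume_image_of_norm_det_fderiv_eq {n : ℕ}
    {g : EuclideanSpace ℂ (Fin n) → EuclideanSpace ℂ (Fin n)} (hg : Differentiable ℂ g)
    (hinj : Function.Injective g) {a : ℝ} (hdet : ∀ z, ‖(fderiv ℂ g z).det‖ = a)
    {S : Set (EuclideanSpace ℂ (Fin n))} (hS : MeasurableSet S) :
    volume (g '' S) = ENNReal.ofReal (a ^ 2) * volume S := by
  rw [← lintegral_abs_det_fderiv_eq_addHaar_image volume hS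
    (fun x _ => ((hg x).hasFDerivAt.restrictScalars ℝ).hasFDerivWithinAt) hinj.injOn]
  have : ∀ x, |((fderiv ℂ g x).restrictScalars ℝ).det| = a ^ 2 := by
    intro x
    have h := LinearMap.det_restrictScalars (R := ℝ) (f := (fderiv ℂ g x).toLinearMap)
    rw [Algebra.norm_complex_apply, Complex.normSq_eq_norm_sq] at h
    change |LinearMap.det ((fderiv ℂ g x).toLinearMap.restrictScalars ℝ)| = _
    rw [h, abs_of_nonneg (by positivity), ← hdet x]
  simp_rw [this]
  rw [setLIntegral_const]

/-- The upper box dimension of a compact set which is invariant under an injective holomorphic map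
that expands volume by the factor `a ^ 2` and distances by less than `L`. -/
theorem upperBoxDim_le_of_mapsTo {n : ℕ}
    {g : EuclideanSpace ℂ (Fin n) → EuclideanSpace ℂ (Fin n)} (hg : ContDiff ℂ 1 g)
    (hinj : Function.Injective g) {a L : ℝ} (ha : 1 ≤ a) (hL : 1 < L)
    (hdet : ∀ z, ‖(fderiv ℂ g z).det‖ = a) {A : Set (EuclideanSpace ℂ (Fin n))}
    (hA : IsCompact A) (hmaps : MapsTo g A A) (hgL : ∀ p ∈ A, ‖fderiv ℂ g p‖ < L) :
    upperBoxDim A ≤ ((2 * n - 2 * Real.log a / Real.log L : ℝ) : EReal) := by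
  have hL0 : 0 < L := by linarith
  -- By compactness, the strict bound on `‖Dg‖` persists on a whole `δ`-neighbourhood of `A`.
  obtain ⟨δ, hδ, hδL⟩ := hA.exists_thickening_subset_open
    (isOpen_lt (hg.continuous_fderiv one_ne_zero).norm continuous_const) hgL
  have hthick : ∀ ε ≤ δ, g '' thickening ε A ⊆ thickening (L * ε) A := by
    rintro ε hε _ ⟨x, hx, rfl⟩
    obtain ⟨p, hp, hxp⟩ := mem_thickening_iff.1 hx
    refine mem_thickening_iff.2 ⟨g p, hmaps hp, ?_⟩
    have hε0 : 0 < ε := dist_nonneg.trans_lt hxp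
    rw [dist_eq_norm]
    refine lt_of_le_of_lt (b := L * ‖x - p‖) ((convex_ball p ε).norm_image_sub_le_of_norm_fderiv_le (𝕜 := ℂ)
      (fun y _ => hg.differentiable one_ne_zero y) (fun y hy => ?_) (mem_ball_self hε0)
      (mem_ball.2 hxp)) ?_
    · exact (hδL (mem_thickening_iff.2 ⟨p, hp, (mem_ball.1 hy).trans_le hε⟩)).le
    · rw [← dist_eq_norm]
      gcongr
  have hvol : ∀ m : ℕ, ENNReal.ofReal ((a ^ 2) ^ m) * volume (thickening (δ / L ^ m) A) ≤
      volume (thickening δ A) := by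
    intro m
    induction m with
    | zero => simp
    -- One application of `g` multiplies the volume of the `δ / L ^ (m + 1)`-neighbourhood by `a ^
    -- 2` and maps it into the `δ / L ^ m`-neighbourhood.
    | succ m ih =>
      refine le_trans ?_ ih
      rw [pow_succ, ENNReal.ofReal_mul (by positivity), mul_assoc]
      gcongr
      rw [← volume_image_of_norm_det_fderiv_eq (hg.differentiable one_ne_zero) hinj hdet
        isOpen_thickening.measurableSet]
      refine measure_mono ((hthick _ ?_).trans (le_of_eq ?_))
      · exact div_le_self hδ.le (one_le_pow₀ hL.le)
      · congr 1
        field_simp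
        ring
  have hfin : volume (thickening δ A) ≠ ⊤ := hA.isBounded.thickening.measure_lt_top.ne
  refine (upperBoxDim_le_of_measure_thickening_le volume hfin hL (one_le_pow₀ ha) hδ hvol).trans ?_
  rw [EReal.coe_le_coe_iff, finrank_real_of_complex, finrank_euclideanSpace, Fintype.card_fin,
    Real.log_pow]
  push_cast
  rfl

end BoxDim

/-! ### Exponential growth rate of the derivatives of iterates -/

section Growth

variable {n : ℕ} {g : EuclideanSpace ℂ (Fin n) → EuclideanSpace ℂ (Fin n)}
  {A B : Set (EuclideanSpace ℂ (Fin n))} {a s : ℝ}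

/-- Leibniz expansion with all entries at most `‖T‖`. The factor `n!` is harmless, as only
exponential rates matter. -/
theorem ContinuousLinearMap.norm_det_le (T : EuclideanSpace ℂ (Fin n) →L[ℂ] EuclideanSpace ℂ (Fin n)) :
    ‖T.det‖ ≤ n.factorial * ‖T‖ ^ n := by
  rw [ContinuousLinearMap.det,
    ← LinearMap.det_toMatrix (EuclideanSpace.basisFun (Fin n) ℂ).toBasis]
  have h := Matrix.det_le (abv := NormedField.toAbsoluteValue ℂ) (x := ‖T‖)
    (A := LinearMap.toMatrix (EuclideanSpace.basisFun (Fin n) ℂ).toBasis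
      (EuclideanSpace.basisFun (Fin n) ℂ).toBasis T.toLinearMap) (fun i j => by
        refine le_trans (b := ‖T (EuclideanSpace.single j 1)‖) ?_ ?_
        · have := PiLp.norm_apply_le (T (EuclideanSpace.single j 1)) i
          simpa [LinearMap.toMatrix_apply, NormedField.toAbsoluteValue] using this
        · simpa using T.le_opNorm (EuclideanSpace.single j (1 : ℂ)))
  simpa [NormedField.toAbsoluteValue] using h

theorem ContDiff.iterate (hg : ContDiff ℂ 1 g) (k : ℕ) : ContDiff ℂ 1 g^[k] := by
  induction k with
  | zero => exact contDiff_id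
  | succ k ih => exact ih.comp hg

theorem det_fderiv_iterate (hg : ContDiff ℂ 1 g) (hdet : ∀ z, ‖(fderiv ℂ g z).det‖ = a) (k : ℕ)
    (z : EuclideanSpace ℂ (Fin n)) : ‖(fderiv ℂ g^[k] z).det‖ = a ^ k := by
  induction k generalizing z with
  | zero =>
    rw [Function.iterate_zero, fderiv_id, pow_zero]
    refine (congrArg norm (LinearMap.det_id (A := ℂ) (M := EuclideanSpace ℂ (Fin n)))).trans ?_
    exact norm_one
  | succ k ih =>
    rw [Function.iterate_succ, fderiv_comp z ((hg.iterate k).differentiable one_ne_zero _)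
      (hg.differentiable one_ne_zero z), pow_succ, ← ih (g z), ← hdet z, ← norm_mul]
    congr 1
    exact LinearMap.det_comp _ _

/-- The supremum of `‖Dgᵏ‖` on `A`. -/
def iterateDerivSup (g : EuclideanSpace ℂ (Fin n) → EuclideanSpace ℂ (Fin n))
    (A : Set (EuclideanSpace ℂ (Fin n))) (k : ℕ) : ℝ :=
  sSup ((fun p => ‖fderiv ℂ g^[k] p‖) '' A)

theorem norm_fderiv_iterate_le (hg : ContDiff ℂ 1 g) (hA : IsCompact A)
    {p : EuclideanSpace ℂ (Fin n)} (hp : p ∈ A) (k : ℕ) :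
    ‖fderiv ℂ g^[k] p‖ ≤ iterateDerivSup g A k :=
  le_csSup (hA.image ((hg.iterate k).continuous_fderiv one_ne_zero).norm).bddAbove
    (mem_image_of_mem _ hp)

/-- The chain rule. With `B = A` it gives the subadditivity behind the existence of the rate; with
two different sets it compares their rates. -/
theorem iterateDerivSup_add_le (hg : ContDiff ℂ 1 g) (hA : IsCompact A) (hAne : A.Nonempty)
    (hB : IsCompact B) {m : ℕ} (hmaps : MapsTo g^[m] A B) (k : ℕ) :
    iterateDerivSup g A (k + m) ≤ iterateDerivSup g B k * iterateDerivSup g A m := by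
  refine csSup_le (hAne.image _) ?_
  rintro _ ⟨p, hp, rfl⟩
  simp only
  rw [Function.iterate_add, fderiv_comp p ((hg.iterate k).differentiable one_ne_zero _)
    ((hg.iterate m).differentiable one_ne_zero p)]
  have h1 := norm_fderiv_iterate_le hg hB (hmaps hp) k
  refine (ContinuousLinearMap.opNorm_comp_le _ _).trans ?_
  exact mul_le_mul h1 (norm_fderiv_iterate_le hg hA hp m) (norm_nonneg _)
    ((norm_nonneg _).trans h1)

theorem pow_le_iterateDerivSup_pow (hg : ContDiff ℂ 1 g)
    (hdet : ∀ z, ‖(fderiv ℂ g z).det‖ = a) (hA : IsCompact A) (hAne : A.Nonempty) (k : ℕ) :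
    a ^ k ≤ n.factorial * iterateDerivSup g A k ^ n := by
  obtain ⟨p, hp⟩ := hAne
  rw [← det_fderiv_iterate hg hdet k p]
  refine (ContinuousLinearMap.norm_det_le _).trans ?_
  gcongr
  exact norm_fderiv_iterate_le hg hA hp k

theorem iterateDerivSup_pos (hn : n ≠ 0) (hg : ContDiff ℂ 1 g) (ha : 0 < a)
    (hdet : ∀ z, ‖(fderiv ℂ g z).det‖ = a) (hA : IsCompact A) (hAne : A.Nonempty) (k : ℕ) :
    0 < iterateDerivSup g A k := by
  have h0 : 0 ≤ iterateDerivSup g A k :=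
    (norm_nonneg _).trans (norm_fderiv_iterate_le hg hA hAne.some_mem k)
  refine h0.lt_of_ne' fun h => ?_
  have := pow_le_iterateDerivSup_pow hg hdet hA hAne k
  rw [h, zero_pow hn, mul_zero] at this
  exact absurd this (not_le.2 (pow_pos ha k))

theorem mul_log_le_log_iterateDerivSup (hn : n ≠ 0) (hg : ContDiff ℂ 1 g) (ha : 0 < a)
    (hdet : ∀ z, ‖(fderiv ℂ g z).det‖ = a) (hA : IsCompact A) (hAne : A.Nonempty) (k : ℕ) :
    k * Real.log a ≤ Real.log n.factorial + n * Real.log (iterateDerivSup g A k) := by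
  have hpos := iterateDerivSup_pos hn hg ha hdet hA hAne k
  have hfac : (0 : ℝ) < n.factorial := by positivity
  have := Real.log_le_log (pow_pos ha k) (pow_le_iterateDerivSup_pow hg hdet hA hAne k)
  rwa [Real.log_pow, Real.log_mul hfac.ne' (by positivity), Real.log_pow] at this

/-- The exponential growth rate of `‖Dgᵏ‖` on a compact invariant set exists, and it is positive if
`g` expands volume. -/
theorem exists_tendsto_log_iterateDerivSup_div (hn : n ≠ 0) (hg : ContDiff ℂ 1 g) (ha : 1 < a)
    (hdet : ∀ z, ‖(fderiv ℂ g z).det‖ = a) (hA : IsCompact A) (hAne : A.Nonempty)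
    (hmaps : MapsTo g A A) :
    ∃ s > 0, Tendsto (fun k : ℕ => Real.log (iterateDerivSup g A k) / k) atTop (𝓝 s) := by
  have hpos := iterateDerivSup_pos hn hg (zero_lt_one.trans ha) hdet hA hAne
  have hn0 : (0 : ℝ) < n := by positivity
  have hloga : 0 < Real.log a := Real.log_pos ha
  have hfac : 0 ≤ Real.log n.factorial :=
    Real.log_nonneg (by exact_mod_cast n.factorial_pos)
  have hsub : Subadditive fun k => Real.log (iterateDerivSup g A k) := by
    intro k m
    rw [← Real.log_mul (hpos k).ne' (hpos m).ne']
    exact Real.log_le_log (hpos _) (iterateDerivSup_add_le hg hA hAne hA (hmaps.iterate m) k)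
  have hlow : ∀ k : ℕ, 0 < k → (Real.log a - Real.log n.factorial / k) / n ≤
      Real.log (iterateDerivSup g A k) / k := by
    intro k hk
    have hk0 : (0 : ℝ) < k := by exact_mod_cast hk
    have := mul_log_le_log_iterateDerivSup hn hg (zero_lt_one.trans ha) hdet hA hAne k
    rw [div_le_div_iff₀ hn0 hk0, sub_mul, div_mul_cancel₀ _ hk0.ne']
    linarith
  have hbdd : BddBelow (range fun k : ℕ => Real.log (iterateDerivSup g A k) / k) := by
    refine ⟨-(Real.log n.factorial) / n, ?_⟩
    rintro _ ⟨k, rfl⟩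
    rcases Nat.eq_zero_or_pos k with rfl | hk
    -- At `k = 0` the quotient is `0` by the convention for division by zero.
    · simp only [Nat.cast_zero, div_zero]
      exact div_nonpos_of_nonpos_of_nonneg (by linarith) hn0.le
    · refine le_trans ?_ (hlow k hk)
      gcongr
      have : Real.log n.factorial / k ≤ Real.log n.factorial :=
        div_le_self hfac (by exact_mod_cast hk)
      linarith
  refine ⟨hsub.lim, lt_of_lt_of_le (div_pos hloga hn0) ?_, hsub.tendsto_lim hbdd⟩
  have hlim : Tendsto (fun k : ℕ => (Real.log a - Real.log n.factorial / k) / n) atTop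
      (𝓝 (Real.log a / n)) := by
    have := (tendsto_const_div_atTop_nhds_zero_nat (Real.log n.factorial)).const_sub (Real.log a)
    simpa using this.div_const (n : ℝ)
  exact le_of_tendsto_of_tendsto hlim (hsub.tendsto_lim hbdd)
    ((eventually_gt_atTop 0).mono hlow)

theorem growthRate_le_of_mapsTo (hn : n ≠ 0) (hg : ContDiff ℂ 1 g) (ha : 0 < a)
    (hdet : ∀ z, ‖(fderiv ℂ g z).det‖ = a) (hA : IsCompact A) (hAne : A.Nonempty)
    (hB : IsCompact B) (hBne : B.Nonempty) {m : ℕ} (hmaps : MapsTo g^[m] A B) {s t : ℝ}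
    (hs : Tendsto (fun k : ℕ => Real.log (iterateDerivSup g A k) / k) atTop (𝓝 s))
    (ht : Tendsto (fun k : ℕ => Real.log (iterateDerivSup g B k) / k) atTop (𝓝 t)) : s ≤ t := by
  have h1 := (tendsto_add_atTop_iff_nat m).2 hs
  -- This factor turns the normalization `1 / (k + m)` into `1 / k`.
  have h2 : Tendsto (fun k : ℕ => 1 + (m : ℝ) / k) atTop (𝓝 1) := by
    simpa using (tendsto_const_div_atTop_nhds_zero_nat (m : ℝ)).const_add 1
  have h3 := ht.add (tendsto_const_div_atTop_nhds_zero_nat (Real.log (iterateDerivSup g A m)))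
  have h4 := h1.mul h2
  rw [mul_one] at h4
  rw [add_zero] at h3
  refine le_of_tendsto_of_tendsto h4 h3 ((eventually_gt_atTop 0).mono fun k hk => ?_)
  have hk0 : (0 : ℝ) < k := by exact_mod_cast hk
  have hpA := iterateDerivSup_pos hn hg ha hdet hA hAne
  have hpB := iterateDerivSup_pos hn hg ha hdet hB hBne
  have h5 := Real.log_le_log (hpA _) (iterateDerivSup_add_le hg hA hAne hB hmaps k)
  rw [Real.log_mul (hpB k).ne' (hpA m).ne'] at h5
  calc Real.log (iterateDerivSup g A (k + m)) / (k + m : ℕ) * (1 + m / k)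
      = Real.log (iterateDerivSup g A (k + m)) / k := by
        push_cast
        field_simp
    _ ≤ (Real.log (iterateDerivSup g B k) + Real.log (iterateDerivSup g A m)) / k := by gcongr
    _ = _ := add_div _ _ _

theorem upperBoxDim_le_of_tendsto_growthRate (hg : ContDiff ℂ 1 g) (hinj : Function.Injective g)
    (ha : 1 < a) (hdet : ∀ z, ‖(fderiv ℂ g z).det‖ = a) (hA : IsCompact A)
    (hmaps : MapsTo g A A) (hn : n ≠ 0) (hAne : A.Nonempty) (hs0 : 0 < s)
    (hs : Tendsto (fun k : ℕ => Real.log (iterateDerivSup g A k) / k) atTop (𝓝 s)) :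
    upperBoxDim A ≤ ((2 * n - 2 * Real.log a / s : ℝ) : EReal) := by
  -- For `t > s` some iterate has `‖Dg^[k]‖ < exp (t * k)` on `A`. It expands volume by `(a ^ k) ^
  -- 2`, so `k` cancels in the ratio of logarithms; then `t` decreases to `s`.
  have key : ∀ t > s, upperBoxDim A ≤ ((2 * n - 2 * Real.log a / t : ℝ) : EReal) := by
    intro t ht
    have ht0 : 0 < t := hs0.trans ht
    obtain ⟨k, hk, hk0⟩ := ((hs.eventually (gt_mem_nhds ht)).and (eventually_gt_atTop 0)).exists
    have hk0' : (0 : ℝ) < k := by exact_mod_cast hk0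
    have hpos := iterateDerivSup_pos hn hg (zero_lt_one.trans ha) hdet hA hAne k
    rw [div_lt_iff₀ hk0', Real.log_lt_iff_lt_exp hpos] at hk
    refine (upperBoxDim_le_of_mapsTo (hg.iterate k) (hinj.iterate k) (one_le_pow₀ ha.le)
      (Real.one_lt_exp_iff.2 (mul_pos ht0 hk0')) (det_fderiv_iterate hg hdet k) hA
      (hmaps.iterate k) fun p hp => (norm_fderiv_iterate_le hg hA hp k).trans_lt hk).trans ?_
    rw [EReal.coe_le_coe_iff, Real.log_exp, Real.log_pow]
    apply le_of_eq
    field_simp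
  have hlim : Tendsto (fun t : ℝ => ((2 * n - 2 * Real.log a / t : ℝ) : EReal)) (𝓝[>] s)
      (𝓝 ((2 * n - 2 * Real.log a / s : ℝ) : EReal)) := by
    refine (continuous_coe_real_ereal.tendsto _).comp ?_
    exact (tendsto_const_nhds.sub (tendsto_const_nhds.div tendsto_id hs0.ne')).mono_left
      nhdsWithin_le_nhds
  exact ge_of_tendsto hlim (eventually_mem_nhdsWithin.mono fun t ht => key t ht)

end Growth

/-! ### Escape to infinity and the sets of bounded orbits -/

namespace PolynomialAutomorphism

open MvPolynomial

variable {n : ℕ} {f : PolynomialAutomorphism n} {R : ℝ} {z : EuclideanSpace ℂ (Fin n)}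

theorem mem_KPlus_iff :
    z ∈ f.KPlus ↔ Bornology.IsBounded (range fun k : ℕ => f.toFun^[k] z) := Iff.rfl

/-- Outside the ball of radius `R`, one of `f` and `f⁻¹` doubles the norm. -/
structure IsEscapeRadius (f : PolynomialAutomorphism n) (R : ℝ) : Prop where
  pos : 0 < R
  two_mul_norm_le : ∀ z, R ≤ ‖z‖ → 2 * ‖z‖ ≤ ‖f.toFun z‖ ∨ 2 * ‖z‖ ≤ ‖f.symm.toFun z‖

theorem IsRegular.exists_isEscapeRadius (hf : f.IsRegular) : ∃ R, f.IsEscapeRadius R := by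
  obtain ⟨c, hc0, R, hR1, hR⟩ := exists_le_norm_evalMap_or (zero_lt_one.trans hf.1)
    (zero_lt_one.trans hf.symm.1) hf.2
  refine ⟨max R (2 / c), lt_max_of_lt_left (by linarith), fun z hz => ?_⟩
  have hzR : R ≤ ‖z‖ := (le_max_left _ _).trans hz
  have hz1 : 1 ≤ ‖z‖ := hR1.trans hzR
  have hzc : 2 ≤ ‖z‖ * c := by
    have := (le_max_right _ _).trans hz
    rwa [div_le_iff₀ hc0] at this
  have hgrow : ∀ {d : ℕ}, 1 < d → 2 * ‖z‖ ≤ c * ‖z‖ ^ d := fun {d} hd => by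
    calc 2 * ‖z‖ ≤ ‖z‖ * c * ‖z‖ := by gcongr
      _ = c * ‖z‖ ^ 2 := by ring
      _ ≤ c * ‖z‖ ^ d := by
        gcongr
        exact hd
  exact (hR z hzR).imp (hgrow hf.1).trans (hgrow hf.symm.1).trans

namespace IsEscapeRadius

theorem symm (hR : f.IsEscapeRadius R) : f.symm.IsEscapeRadius R :=
  ⟨hR.pos, fun z hz => (hR.two_mul_norm_le z hz).symm⟩

/-- At `f(z)` the inverse leads back to the smaller point `z`, so the map that doubles the norm
there is again `f`. -/
theorem escape_toFun (hR : f.IsEscapeRadius R) (hz : R ≤ ‖z‖) (h : 2 * ‖z‖ ≤ ‖f.toFun z‖) :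
    2 * ‖f.toFun z‖ ≤ ‖f.toFun (f.toFun z)‖ := by
  have hpos := hR.pos
  refine (hR.two_mul_norm_le (f.toFun z) (by linarith)).resolve_right fun h' => ?_
  rw [f.symm_toFun_toFun] at h'
  linarith

theorem notMem_KPlus (hR : f.IsEscapeRadius R) (hz : R ≤ ‖z‖) (h : 2 * ‖z‖ ≤ ‖f.toFun z‖) :
    z ∉ f.KPlus := by
  intro hK
  have hpos := hR.pos
  have key : ∀ k : ℕ, 2 ^ k * ‖z‖ ≤ ‖f.toFun^[k] z‖ ∧
      2 * ‖f.toFun^[k] z‖ ≤ ‖f.toFun (f.toFun^[k] z)‖ := by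
    intro k
    induction k with
    | zero => simpa using h
    | succ k ih =>
      have h1 : ‖z‖ ≤ 2 ^ k * ‖z‖ :=
        le_mul_of_one_le_left (norm_nonneg _) (one_le_pow₀ one_le_two)
      rw [Function.iterate_succ_apply']
      refine ⟨?_, hR.escape_toFun (by linarith) ih.2⟩
      rw [pow_succ]
      linarith
  obtain ⟨C, hC⟩ := (mem_KPlus_iff.1 hK).exists_norm_le
  obtain ⟨k, hk⟩ := pow_unbounded_of_one_lt (C / ‖z‖) (one_lt_two (α := ℝ))
  rw [div_lt_iff₀ (by linarith)] at hk
  have := hC _ ⟨k, rfl⟩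
  exact absurd (hk.trans_le (key k).1) (not_lt.2 this)

end IsEscapeRadius

theorem toFun_mem_KPlus_iff : f.toFun z ∈ f.KPlus ↔ z ∈ f.KPlus := by
  constructor
  · intro h
    refine mem_KPlus_iff.2 (((Bornology.isBounded_singleton (x := z)).union
      (mem_KPlus_iff.1 h)).subset ?_)
    rintro _ ⟨k, rfl⟩
    rcases k with _ | k
    · exact Or.inl rfl
    · exact Or.inr ⟨k, rfl⟩
  · intro h
    refine mem_KPlus_iff.2 ((mem_KPlus_iff.1 h).subset ?_)
    rintro _ ⟨k, rfl⟩
    exact ⟨k + 1, rfl⟩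

theorem toFun_mem_JPlus_iff : f.toFun z ∈ f.JPlus ↔ z ∈ f.JPlus := by
  have h := f.homeomorph.preimage_frontier f.KPlus
  have h' : f.homeomorph ⁻¹' f.KPlus = f.KPlus := Set.ext fun z => toFun_mem_KPlus_iff
  rw [h'] at h
  exact Set.ext_iff.1 h z

theorem iterate_mem_KPlus_iff (k : ℕ) : f.toFun^[k] z ∈ f.KPlus ↔ z ∈ f.KPlus := by
  induction k generalizing z with
  | zero => rfl
  | succ k ih => rw [Function.iterate_succ_apply, ih, toFun_mem_KPlus_iff]

namespace IsEscapeRadius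

theorem norm_toFun_le (hR : f.IsEscapeRadius R) (hz : z ∈ f.KPlus) {ρ : ℝ} (hρ : R ≤ ρ)
    (hzρ : ‖z‖ ≤ ρ) : ‖f.toFun z‖ ≤ ρ := by
  by_contra! h
  have hK := toFun_mem_KPlus_iff.2 hz
  have hRf : R ≤ ‖f.toFun z‖ := hρ.trans h.le
  rcases hR.two_mul_norm_le _ hRf with h' | h'
  · exact hR.notMem_KPlus hRf h' hK
  · rw [f.symm_toFun_toFun] at h'
    linarith [hR.pos]

/-- An orbit point outside the ball at which `f` does not double has a predecessor at least twice as
large, so the orbit never exceeds `max ‖z‖ R`. -/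
theorem mem_KPlus (hR : f.IsEscapeRadius R)
    (h : ∀ k, R ≤ ‖f.toFun^[k] z‖ → ¬ 2 * ‖f.toFun^[k] z‖ ≤ ‖f.toFun (f.toFun^[k] z)‖) :
    z ∈ f.KPlus := by
  refine mem_KPlus_iff.2 (isBounded_iff_forall_norm_le.2 ⟨max ‖z‖ R, ?_⟩)
  rintro _ ⟨k, rfl⟩
  induction k with
  | zero => exact le_max_left _ _
  | succ k ih =>
    by_contra! hlt
    have hRk : R ≤ ‖f.toFun^[k + 1] z‖ := (le_max_right _ _).trans hlt.le
    have h1 := (hR.two_mul_norm_le _ hRk).resolve_left (h (k + 1) hRk)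
    have h0 : f.symm.toFun (f.toFun^[k + 1] z) = f.toFun^[k] z := by
      rw [Function.iterate_succ_apply', f.symm_toFun_toFun]
    rw [h0] at h1
    have hpos := hR.pos
    simp only at ih hlt
    linarith

theorem isClosed_KPlus (hR : f.IsEscapeRadius R) : IsClosed f.KPlus := by
  rw [← isOpen_compl_iff, isOpen_iff_mem_nhds]
  intro z hz
  have hex : ∃ k, R ≤ ‖f.toFun^[k] z‖ ∧ 2 * ‖f.toFun^[k] z‖ ≤ ‖f.toFun (f.toFun^[k] z)‖ := by
    by_contra! h
    exact hz (hR.mem_KPlus fun k hk => not_le.2 (h k hk))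
  obtain ⟨k, hk1, hk2⟩ := hex
  have hpos := hR.pos
  -- Doubling is not an open condition. One step further along the orbit it is implied by two strict
  -- inequalities: the point is outside the ball and `f⁻¹` fails to double there.
  obtain ⟨g, hg, hgK, hgz, hgz'⟩ : ∃ g : EuclideanSpace ℂ (Fin n) → EuclideanSpace ℂ (Fin n),
      Continuous g ∧ (∀ w, g w ∈ f.KPlus ↔ w ∈ f.KPlus) ∧ R < ‖g z‖ ∧
      ‖f.symm.toFun (g z)‖ < 2 * ‖g z‖ := by
    refine ⟨f.toFun^[k + 1], f.continuous_toFun.iterate (k + 1),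
      fun w => iterate_mem_KPlus_iff (k + 1), ?_, ?_⟩
    · rw [Function.iterate_succ_apply']
      linarith
    · rw [Function.iterate_succ_apply', f.symm_toFun_toFun]
      linarith
  filter_upwards [hg.norm.continuousAt.eventually_const_lt hgz,
    (f.symm.continuous_toFun.comp hg).norm.continuousAt.eventually_lt
      (continuous_const.mul hg.norm).continuousAt hgz'] with w hw hw' hwK
  refine hR.notMem_KPlus hw.le ?_ ((hgK w).2 hwK)
  exact (hR.two_mul_norm_le _ hw.le).resolve_right (not_le.2 hw')

theorem norm_lt_of_mem_K (hR : f.IsEscapeRadius R) (hz : z ∈ f.K) : ‖z‖ < R := by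
  by_contra! h
  rcases hR.two_mul_norm_le z h with h' | h'
  · exact hR.notMem_KPlus h h' hz.1
  · exact hR.symm.notMem_KPlus h h' hz.2

theorem JPlus_subset_KPlus (hR : f.IsEscapeRadius R) : f.JPlus ⊆ f.KPlus :=
  hR.isClosed_KPlus.frontier_subset

theorem mapsTo_JPlus_closedBall (hR : f.IsEscapeRadius R) :
    MapsTo f.toFun (f.JPlus ∩ Metric.closedBall 0 R) (f.JPlus ∩ Metric.closedBall 0 R) := by
  rintro z ⟨hz, hzR⟩
  refine ⟨toFun_mem_JPlus_iff.2 hz, ?_⟩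
  rw [mem_closedBall_zero_iff] at hzR ⊢
  exact hR.norm_toFun_le (hR.JPlus_subset_KPlus hz) le_rfl hzR

theorem isAdmissible_closedBall (hR : f.IsEscapeRadius R) :
    f.IsAdmissible (Metric.closedBall 0 R) where
  isCompact := isCompact_closedBall 0 R
  K_subset_interior := fun _ hz => Metric.ball_subset_interior_closedBall
    (mem_ball_zero_iff.2 (hR.norm_lt_of_mem_K hz))
  mapsTo_JPlus := hR.mapsTo_JPlus_closedBall
  mapsTo_JMinus := hR.symm.mapsTo_JPlus_closedBall

open MeasureTheory in
/-- If `f` expands volume, the points with bounded orbits form a null set. -/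
theorem volume_KPlus_eq_zero (hR : f.IsEscapeRadius R) {a : ℝ} (ha : 1 < a)
    (hdet : ∀ z, ‖f.jacobianDet z‖ = a) : volume f.KPlus = 0 := by
  have hball : ∀ m : ℕ, volume (f.KPlus ∩ Metric.closedBall 0 (R + m)) = 0 := by
    intro m
    set S := f.KPlus ∩ Metric.closedBall (0 : EuclideanSpace ℂ (Fin n)) (R + m)
    have hS : MeasurableSet S :=
      (hR.isClosed_KPlus.inter Metric.isClosed_closedBall).measurableSet
    have hsub : f.toFun '' S ⊆ S := by
      rintro _ ⟨z, ⟨hz, hzR⟩, rfl⟩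
      refine ⟨toFun_mem_KPlus_iff.2 hz, ?_⟩
      rw [mem_closedBall_zero_iff] at hzR ⊢
      exact hR.norm_toFun_le hz (by simp) hzR
    have hle := measure_mono (μ := volume) hsub
    rw [volume_image_of_norm_det_fderiv_eq f.differentiable_toFun
      (Function.LeftInverse.injective f.symm_toFun_toFun) hdet hS] at hle
    have hfin : volume S ≠ ⊤ :=
      ((measure_mono inter_subset_right).trans_lt Metric.isBounded_closedBall.measure_lt_top).ne
    by_contra h0
    have h1 : 1 < ENNReal.ofReal (a ^ 2) := by
      rw [ENNReal.one_lt_ofReal]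
      exact one_lt_pow₀ ha two_ne_zero
    have h2 := ENNReal.mul_lt_mul_left h0 hfin h1
    rw [one_mul] at h2
    exact absurd h2 (not_lt.2 hle)
  refine measure_mono_null (fun z hz => ?_) (measure_iUnion_null hball)
  obtain ⟨m, hm⟩ := exists_nat_ge ‖z‖
  exact mem_iUnion.2 ⟨m, hz, mem_closedBall_zero_iff.2 (by linarith [hR.pos])⟩

/-- A closed null set has empty interior and is its own boundary. Used for `f⁻¹`, this transfers the
estimate from `J⁻` to `K⁻`. -/
theorem JPlus_eq_KPlus (hR : f.IsEscapeRadius R) {a : ℝ} (ha : 1 < a)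
    (hdet : ∀ z, ‖f.jacobianDet z‖ = a) : f.JPlus = f.KPlus := by
  have hint : interior f.KPlus = ∅ := by
    by_contra hne
    exact (isOpen_interior.measure_pos MeasureTheory.volume (nonempty_iff_ne_empty.2 hne)).ne'
      (MeasureTheory.measure_mono_null interior_subset (hR.volume_KPlus_eq_zero ha hdet))
  rw [JPlus, frontier, hint, sdiff_empty, hR.isClosed_KPlus.closure_eq]

end IsEscapeRadius

/-! ### Independence of the admissible set, and the dimension bounds -/

theorem iterate_toFun_symm_iterate (k : ℕ) (z : EuclideanSpace ℂ (Fin n)) :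
    f.toFun^[k] (f.symm.toFun^[k] z) = z :=
  Function.LeftInverse.iterate f.toFun_symm_toFun k z

/-- Some backward iterate of `f` maps `J⁻ ∩ V` into `J⁻ ∩ W`, for admissible `V` and `W`. -/
theorem IsAdmissible.exists_mapsTo_iterate {V W : Set (EuclideanSpace ℂ (Fin n))}
    (hV : f.IsAdmissible V) (hW : f.IsAdmissible W) (hJ : f.JMinus ⊆ f.KMinus) :
    ∃ m, MapsTo f.symm.toFun^[m] (f.JMinus ∩ V) (f.JMinus ∩ W) := by
  set A := f.JMinus ∩ V
  have hAc : IsCompact A := hV.isCompact.inter_left isClosed_frontier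
  have hmaps : MapsTo f.symm.toFun A A := hV.mapsTo_JMinus
  have hsub : ∀ k, f.symm.toFun^[k] '' A ⊆ A := fun k => (hmaps.iterate k).image_subset
  have hanti : Antitone fun k => f.symm.toFun^[k] '' A := by
    refine antitone_nat_of_succ_le fun k => ?_
    rintro _ ⟨z, hz, rfl⟩
    exact ⟨f.symm.toFun z, hmaps hz, rfl⟩
  -- A point in all the decreasing images has its whole forward orbit in the compact set `A`, so it
  -- lies in `K`, hence in the interior of `W`. By compactness a single image already lies in `W`.
  obtain ⟨m, hm⟩ := exists_subset_nhds_of_isCompact (V := fun k => f.symm.toFun^[k] '' A)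
    hanti.directed_ge (fun k => hAc.image (f.symm.continuous_toFun.iterate k)) (U := W) (by
      intro x hx
      rw [mem_iInter] at hx
      refine mem_interior_iff_mem_nhds.1 (hW.K_subset_interior ⟨?_, ?_⟩)
      · refine hAc.isBounded.subset ?_
        rintro _ ⟨k, rfl⟩
        obtain ⟨y, hy, hyx⟩ := hx k
        simp only
        rw [← hyx, iterate_toFun_symm_iterate]
        exact hy
      · exact hJ (hsub 0 (hx 0)).1)
  exact ⟨m, fun z hz => ⟨(hmaps.iterate m hz).1, hm ⟨z, hz, rfl⟩⟩⟩

theorem isVolumeDecreasing_iff (p : EuclideanSpace ℂ (Fin n)) :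
    f.IsVolumeDecreasing ↔ ‖f.jacobianDet p‖ < 1 :=
  ⟨fun h => h p, fun h q => by rwa [f.jacobianDet_eq q p]⟩

theorem norm_jacobianDet_symm (p q : EuclideanSpace ℂ (Fin n)) :
    ‖f.symm.jacobianDet p‖ = ‖f.jacobianDet q‖⁻¹ := by
  rw [f.symm.jacobianDet_eq p (f.toFun q)]
  refine eq_inv_of_mul_eq_one_left ?_
  rw [← norm_mul, f.det_fderiv_symm_mul_det_fderiv, norm_one]

theorem backwardGrowth_eq (V : Set (EuclideanSpace ℂ (Fin n))) :
    f.backwardGrowth V =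
      fun k : ℕ => Real.log (iterateDerivSup f.symm.toFun (f.JMinus ∩ V) k) / k := by
  funext k
  rw [backwardGrowth, one_div_mul_eq_div]
  rfl

theorem IsRegular.exists_backwardGrowth_rate (hn : n ≠ 0) (hf : f.IsRegular)
    (hvol : f.IsVolumeDecreasing) :
    ∃ s : ℝ, 0 < s ∧ ∀ V, f.IsAdmissible V → Tendsto (f.backwardGrowth V) atTop (𝓝 s) ∧
      ∀ p, upperBoxDim (f.KMinus ∩ V) ≤
          ((2 * n + 2 * Real.log ‖f.jacobianDet p‖ / s : ℝ) : EReal) ∧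
        2 * n + 2 * Real.log ‖f.jacobianDet p‖ / s < (2 * n : ℝ) := by
  obtain ⟨R, hR⟩ := hf.exists_isEscapeRadius
  set a := ‖f.jacobianDet 0‖⁻¹ with ha_def
  have hdet : ∀ z, ‖f.symm.jacobianDet z‖ = a := fun z => norm_jacobianDet_symm z 0
  have hjpos : ∀ p, 0 < ‖f.jacobianDet p‖ := fun p => norm_pos_iff.2 (f.jacobianDet_ne_zero p)
  have ha : 1 < a := (one_lt_inv₀ (hjpos 0)).2 (hvol 0)
  have hJK : f.JMinus = f.KMinus := hR.symm.JPlus_eq_KPlus ha hdet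
  have hg := f.symm.contDiff_toFun
  have hinj : Function.Injective f.symm.toFun :=
    Function.LeftInverse.injective f.toFun_symm_toFun
  have hcpt : ∀ V, f.IsAdmissible V → IsCompact (f.JMinus ∩ V) := fun V hV =>
    hV.isCompact.inter_left isClosed_frontier
  have hne : ∀ V, f.IsAdmissible V → (f.JMinus ∩ V).Nonempty := fun V hV => by
    obtain ⟨z, hz⟩ := hf.nonempty_K
    exact ⟨z, hJK ▸ hz.2, interior_subset (hV.K_subset_interior hz)⟩
  have hrate := fun V hV => exists_tendsto_log_iterateDerivSup_div hn hg ha hdet (hcpt V hV)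
    (hne V hV) hV.mapsTo_JMinus
  have hle : ∀ {V W : Set (EuclideanSpace ℂ (Fin n))} {s t : ℝ}, f.IsAdmissible V →
      f.IsAdmissible W →
      Tendsto (fun k : ℕ => Real.log (iterateDerivSup f.symm.toFun (f.JMinus ∩ V) k) / k) atTop
        (𝓝 s) →
      Tendsto (fun k : ℕ => Real.log (iterateDerivSup f.symm.toFun (f.JMinus ∩ W) k) / k) atTop
        (𝓝 t) → s ≤ t := by
    intro V W s t hV hW hs ht
    obtain ⟨m, hm⟩ := hV.exists_mapsTo_iterate hW hJK.subset
    exact growthRate_le_of_mapsTo hn hg (zero_lt_one.trans ha) hdet (hcpt V hV) (hne V hV)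
      (hcpt W hW) (hne W hW) hm hs ht
  have hV₀ := hR.isAdmissible_closedBall
  obtain ⟨s, hs0, hs⟩ := hrate _ hV₀
  refine ⟨s, hs0, fun V hV => ?_⟩
  obtain ⟨t, -, ht⟩ := hrate V hV
  -- Each of the two sets is mapped into the other by some backward iterate, so the rates agree.
  have hts : t = s := le_antisymm (hle hV hV₀ ht hs) (hle hV₀ hV hs ht)
  rw [hts] at ht
  refine ⟨by rwa [backwardGrowth_eq], fun p => ?_⟩
  have hloga : Real.log a = -Real.log ‖f.jacobianDet p‖ := by
    rw [ha_def, Real.log_inv, f.jacobianDet_eq p 0]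
  have hlog : Real.log ‖f.jacobianDet p‖ < 0 := Real.log_neg (hjpos p) (hvol p)
  refine ⟨?_, ?_⟩
  · have := upperBoxDim_le_of_tendsto_growthRate hg hinj ha hdet (hcpt V hV) hV.mapsTo_JMinus hn
      (hne V hV) hs0 ht
    rwa [hloga, hJK, mul_neg, neg_div, sub_neg_eq_add] at this
  · have : 2 * Real.log ‖f.jacobianDet p‖ / s < 0 := div_neg_of_neg_of_pos (by linarith) hs0
    linarith

theorem IsRegular.upperBoxDim_K_lt_of_isVolumeDecreasing (hn : n ≠ 0) (hf : f.IsRegular)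
    (hvol : f.IsVolumeDecreasing) : upperBoxDim f.K < ((2 * n : ℝ) : EReal) := by
  obtain ⟨R, hR⟩ := hf.exists_isEscapeRadius
  have hV := hR.isAdmissible_closedBall
  obtain ⟨s, -, h⟩ := hf.exists_backwardGrowth_rate hn hvol
  obtain ⟨h1, h2⟩ := (h _ hV).2 0
  have hsub : f.K ⊆ f.KMinus ∩ Metric.closedBall 0 R :=
    subset_inter inter_subset_right (hV.K_subset_interior.trans interior_subset)
  exact lt_of_le_of_lt ((upperBoxDim_mono hsub).trans h1) (EReal.coe_lt_coe_iff.2 h2)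

end PolynomialAutomorphism

end

theorem mainTheorem5 {n : ℕ} (hn : 2 ≤ n) (f : PolynomialAutomorphism n) (hf : f.IsRegular) :
    (f.IsVolumeDecreasing →
      (∃ V, f.IsAdmissible V) ∧
      ∃ s : ℝ, 0 < s ∧ ∀ V, f.IsAdmissible V →
        Tendsto (f.backwardGrowth V) atTop (𝓝 s) ∧
        ∀ p, upperBoxDim (f.KMinus ∩ V) ≤
              ((2 * n + 2 * Real.log ‖f.jacobianDet p‖ / s : ℝ) : EReal) ∧
            2 * n + 2 * Real.log ‖f.jacobianDet p‖ / s < (2 * n : ℝ)) ∧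
    (¬ f.IsVolumePreserving → upperBoxDim f.K < ((2 * n : ℝ) : EReal)) := by
  have hn0 : n ≠ 0 := by omega
  refine ⟨fun hvol => ⟨?_, hf.exists_backwardGrowth_rate hn0 hvol⟩, fun hvol => ?_⟩
  · obtain ⟨R, hR⟩ := hf.exists_isEscapeRadius
    exact ⟨_, hR.isAdmissible_closedBall⟩
  · simp only [PolynomialAutomorphism.IsVolumePreserving, not_forall] at hvol
    obtain ⟨p, hp⟩ := hvol
    rcases lt_or_gt_of_ne hp with h | h
    · exact hf.upperBoxDim_K_lt_of_isVolumeDecreasing hn0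
        ((PolynomialAutomorphism.isVolumeDecreasing_iff p).2 h)
    -- A volume increasing `f` has a volume decreasing inverse with the same `K`.
    · have hK : f.K = f.symm.K := inter_comm _ _
      rw [hK]
      refine hf.symm.upperBoxDim_K_lt_of_isVolumeDecreasing hn0
        ((PolynomialAutomorphism.isVolumeDecreasing_iff p).2 ?_)
      rw [PolynomialAutomorphism.norm_jacobianDet_symm p p]
      exact inv_lt_one_of_one_lt₀ h
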